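/- **Notation.** Let $q=p^v$ with $p$ prime and $v\ge 1$, and let $k\ge 2$ be an integer. Let $\delta_n(a,b)$ be $1$ if $a\equiv b \pmod n$ and $0$ otherwise. For $j\ge 0$ let $U_j(t,q)=q^{j/2}\,U_j\!\left(\tfrac{t}{2\sqrt q}\right)$, where $U_j$ is the $j$-th Chebyshev polynomial of the second kind. Let $\left(\frac{a}{p}\right)$ be the Kronecker symbol. For $d<0$, $d\equiv 0,1\pmod 4$, let $h(d)$ be the class number of the quadratic order of discriminant $d$, and put $h_w(-3)=h(-3)/3$, $h_w(-4)=h(-4)/2$, $h_w(d)=h(d)$ for all other such $d$, and $h_w(d)=0$ for all other integers $d$. Let $H(\Delta)=\sum_{f\ge 1,\ f^2\mid\Delta}h_w(\Delta/f^2)$ for nonzero integers $\Delta$, and $H(x)=0$ if $x$ is not an integer. Let $n_2\mid n_1$ be positive integers prime to $p$ and $d$ an integer prime to $n_1$. Put $D(t;n)=1$ if $dq+d^{-1}\equiv t\pmod n$ and $D(t;n)=0$ otherwise (with $d^{-1}$ the inverse of $d$ modulo $n$); this is used only for $n$ prime to $d$. Write $m\,\|\,n_1$ if $m\mid n_1$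 and $v_\ell(m)=v_\ell(n_1)$ for all primes $\ell\mid m$; write $\mu\prec m$ if $\mu\geq 1$ and $m$ have the same prime divisors and $v_\ell(\mu)\le v_\ell(n_1/n_2)-1$ for all primes $\ell\mid m$; let $\omega(m)$ be the number of prime divisors of $m$. For $m\,\|\,n_1$ and $\mu\prec m$ put $$D_{m,\mu}(t)=\prod_{\ell\mid m}\left(D(t;\ell^{v_\ell(n_1n_2\mu)-1})-D(t;\ell^{v_\ell(n_1n_2\mu)})\right)\prod_{\ell\mid n_1,\ \ell\nmid m}D(t;\ell^{v_\ell(n_1n_2)}),$$ the products being over primes $\ell$. Define $$H_{n_1,n_2}(t,q,d)=\tfrac12 H\!\left(\tfrac{t^2-4q}{n_2^2}\right)\delta_{n_2}(d^2q,1)D(t;n_1n_2)+\sum_{\substack{m\| n_1\\ m\ge2}}\ \sum_{\mu\prec m}(-1)^{\omega(m)}\,\tfrac12 H\!\left(\tfrac{t^2-4q}{(n_2\mu)^2}\right)\delta_{n_2\mu}(d^2q,1)\,D_{m,\mu}(t).$$ This definition is used also with $q$ replaced by $1=p^0$. Define $H^*_{n_1,n_2}(t,q,d)$ as follows; it is $0$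 in all cases not listed. * If $n_2=2$: it is $\tfrac12h_w(-p)D(t;2n_1)$ for $t=0$. * If $n_2=1$ and $v$ is even: it is $\tfrac14\left(1-\left(\frac{-4}{p}\right)\right)D(t;n_1)$ for $t=0$, and $\tfrac16\left(1-\left(\frac{-3}{p}\right)\right)D(t;n_1)$ for $t^2=q$. * If $n_2=1$ and $v$ is odd: it is $\tfrac12H(-4p)D(t;n_1)-\delta_4(n_1,0)\tfrac12h_w(-p)\left(D(t;n_1)-D(t;2n_1)\right)$ for $t=0$, it is $\tfrac14D(t;n_1)$ for $p=2$ and $t^2=2q$, and $\tfrac16D(t;n_1)$ for $p=3$ and $t^2=3q$. For a finite abelian group $A$ of rank at most $2$ let $n_2(A)\mid n_1(A)$ be its invariant factors, so that $A\cong\mathbb Z/n_1(A)\times\mathbb Z/n_2(A)$. Over integers $t$, set $$\omega_A(q,d)=\sum_{\substack{t^2<4q\\ p\nmid t}}U_{k-2}(t,q)H_{n_1(A),n_2(A)}(t,q,d),\qquad \omega^*_A(q,d)=\sum_{t^2<4q}U_{k-2}(t,q)H^*_{n_1(A),n_2(A)}(t,q,d),$$ $$\Sigma_{n_1,n_2}(q,d)=\sum_{t^2<4q}U_{k-2}(t,q)H_{n_1,n_2}(t,q,d),\qquad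 \Sigma_{n_1,n_2}(p^{-1},d)=0.$$ **Proposition.** Let $A$ be a finite abelian group of rank at most $2$, let $q=p^v$ with $p$ prime and $v\ge1$ be such that $(q,|A|)=1$, and let $k\ge2$. Then $$\omega_A(q,1)+\omega_A^*(q,1)=\Sigma_{n_1(A),n_2(A)}(q,1)-p^{k-1}\,\Sigma_{n_1(A),n_2(A)}(q/p^2,p).$$ -/

import Mathlib

/-! ### Indicator functions, Kronecker symbol, Chebyshev polynomials -/

/-- The indicator function `δ_n(a, b)` of the congruence `a ≡ b (mod n)`. -/
noncomputable def deltaMod (n : ℕ) (a b : ℤ) : ℝ :=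
  open Classical in if a ≡ b [ZMOD (n : ℤ)] then 1 else 0

/-- The Kronecker symbol `(a / p)` at a prime number `p`. For odd `p` it is the quadratic residue
symbol (on primes the Jacobi symbol of Mathlib is the Legendre symbol). -/
noncomputable def kroneckerPrime (a : ℤ) (p : ℕ) : ℤ :=
  if p = 2 then
    (if (2 : ℤ) ∣ a then 0 else if a % 8 = 1 ∨ a % 8 = 7 then 1 else -1)
  else jacobiSym a p

/-- The normalized Chebyshev polynomial of the second kind
`U_j(t, q) = q^{j/2} U_j(t / (2 √q))`. -/
noncomputable def normChebyshev (j : ℕ) (t : ℤ) (q : ℕ) : ℝ :=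
  Real.sqrt q ^ j * (Polynomial.Chebyshev.U ℝ (j : ℤ)).eval ((t : ℝ) / (2 * Real.sqrt q))

/-! ### Class numbers of imaginary quadratic orders -/

/-- For `d < 0` with `d ≡ 0, 1 (mod 4)`, the quadratic order `ℤ[(d + √d) / 2]` of discriminant
`d`, as a subring of `ℂ`. -/
noncomputable def quadOrder (d : ℤ) : Subalgebra ℤ ℂ :=
  Algebra.adjoin ℤ {((d : ℂ) + Complex.I * (Real.sqrt (-(d : ℝ)) : ℂ)) / 2}

/-- The class number `h(d)` of the quadratic order of discriminant `d`: the order of the group of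
invertible fractional ideals modulo principal ones. -/
noncomputable def orderClassNumber (d : ℤ) : ℕ :=
  Nat.card (ClassGroup (quadOrder d))

/-- The weighted class number `h_w(d)`. -/
noncomputable def weightedClassNumber (d : ℤ) : ℝ :=
  if d = -3 then (orderClassNumber d : ℝ) / 3
  else if d = -4 then (orderClassNumber d : ℝ) / 2
  else if d < 0 ∧ (d % 4 = 0 ∨ d % 4 = 1) then (orderClassNumber d : ℝ)
  else 0

/-- The Hurwitz–Kronecker class number `H(Δ) = ∑_{f² ∣ Δ} h_w(Δ / f²)`, the sum being over
positive integers `f`. It vanishes unless `Δ < 0` and `Δ ≡ 0, 1 (mod 4)`. -/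
noncomputable def hurwitzClassNumber (Δ : ℤ) : ℝ :=
  ∑ f ∈ Δ.natAbs.divisors.filter (fun f : ℕ => (f : ℤ) ^ 2 ∣ Δ),
    weightedClassNumber (Δ / (f : ℤ) ^ 2)

/-- `H(Δ / n²)`, understood as `0` if `Δ / n²` is not an integer. -/
noncomputable def hurwitzQuot (Δ : ℤ) (n : ℕ) : ℝ :=
  open Classical in
  if (n : ℤ) ^ 2 ∣ Δ then hurwitzClassNumber (Δ / (n : ℤ) ^ 2) else 0

/-! ### The class numbers `H_{n₁,n₂}(t, q, d)` -/

/-- `D(t; n)`, the indicator function of `d q + d⁻¹ ≡ t (mod n)`. Here the integer `d` is prime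
to `n₁` and represents a class in `(ℤ / n₁)ˣ`; the lemma below says that the value depends only on
this class whenever `n ∣ n₁ n'` with `n' ∣ n₁` and `d² q ≡ 1 (mod n')`. -/
noncomputable def indD (q : ℕ) (d t : ℤ) (n : ℕ) : ℝ :=
  open Classical in if (d : ZMod n) * (q : ZMod n) + (d : ZMod n)⁻¹ = (t : ZMod n) then 1 else 0

lemma indD_wellDefined {q n₁ n' n : ℕ} {d d' t : ℤ} (hn' : n' ∣ n₁) (hn : n ∣ n₁ * n')
    (hd : IsCoprime d (n₁ : ℤ)) (hdd' : d ≡ d' [ZMOD (n₁ : ℤ)])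
    (hdq : d ^ 2 * q ≡ 1 [ZMOD (n' : ℤ)]) : indD q d t n = indD q d' t n := by
  have hd' : IsCoprime d' (n₁ : ℤ) := by
    obtain ⟨c, hc⟩ := hdd'.dvd
    have : d' = d + (n₁ : ℤ) * c := by linarith
    rw [this]
    exact hd.add_mul_left_left c
  have hnz : (n : ℤ) ∣ (n₁ : ℤ) ^ 2 := by
    refine (Int.natCast_dvd_natCast.mpr hn).trans ?_
    rw [pow_two]
    push_cast
    exact mul_dvd_mul_left _ (Int.natCast_dvd_natCast.mpr hn')
  have key : ∀ e : ℤ, IsCoprime e (n₁ : ℤ) → (e : ZMod n) * (e : ZMod n)⁻¹ = 1 := by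
    intro e he
    have h1 : IsCoprime e (n : ℤ) := (he.pow_right (n := 2)).of_isCoprime_of_dvd_right hnz
    exact ZMod.coe_int_mul_inv_eq_one h1
  have h1 := key d hd
  have h2 := key d' hd'
  have hdiv : (n : ℤ) ∣ (d' - d) * (1 - d * d' * q) := by
    refine (Int.natCast_dvd_natCast.mpr hn).trans ?_
    push_cast
    refine mul_dvd_mul hdd'.dvd ?_
    have a1 : (n' : ℤ) ∣ 1 - d ^ 2 * q := hdq.dvd
    have a2 : (n' : ℤ) ∣ d' - d := (Int.natCast_dvd_natCast.mpr hn').trans hdd'.dvd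
    have : 1 - d * d' * q = (1 - d ^ 2 * q) - (d' - d) * (d * q) := by ring
    rw [this]
    exact dvd_sub a1 (a2.mul_right _)
  have hz : ((d' : ZMod n) - d) * (1 - d * d' * q) = 0 := by
    have := (ZMod.intCast_zmod_eq_zero_iff_dvd _ n).mpr hdiv
    push_cast at this
    exact this
  have heq : (d : ZMod n) * (q : ZMod n) + (d : ZMod n)⁻¹
      = (d' : ZMod n) * (q : ZMod n) + (d' : ZMod n)⁻¹ := by
    linear_combination ((d : ZMod n)⁻¹ * (d' : ZMod n)⁻¹) * hz
      + (-(d : ZMod n)⁻¹ - q * (d - d') * (d * (d : ZMod n)⁻¹)) * h2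
      + ((d' : ZMod n)⁻¹ - q * (d - d')) * h1
  unfold indD
  rw [heq]

/-- `m` is a full divisor of `n₁`, written `m ∥ n₁`: for all primes `ℓ ∣ m`,
`v_ℓ(m) = v_ℓ(n₁)`. -/
def IsFullDivisor (m n₁ : ℕ) : Prop :=
  m ∣ n₁ ∧ ∀ ℓ ∈ m.primeFactors, m.factorization ℓ = n₁.factorization ℓ

/-- The relation `μ ≺ m` (depending on `n₁` and `n₂`): the positive integers `μ` and `m` have the
same prime divisors, and `v_ℓ(μ) ≤ v_ℓ(n₁ / n₂) - 1` for every prime `ℓ ∣ m`. -/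
def Prec (n₁ n₂ μ m : ℕ) : Prop :=
  μ ≠ 0 ∧ μ.primeFactors = m.primeFactors ∧
    ∀ ℓ ∈ m.primeFactors, μ.factorization ℓ + 1 ≤ (n₁ / n₂).factorization ℓ

/-- The local factors at the primes `ℓ ∣ n₁` that go with `μ ≺ m`, `m ∥ n₁`: the factor
`D(t; ℓ^{v_ℓ(n₁ n₂ μ) - 1}) - D(t; ℓ^{v_ℓ(n₁ n₂ μ)})` if `ℓ ∣ m`, and the factor
`D(t; ℓ^{v_ℓ(n₁ n₂)})` if `ℓ ∤ m`. -/
noncomputable def localFactors (n₁ n₂ m μ : ℕ) (q : ℕ) (d t : ℤ) : ℝ :=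
  (∏ ℓ ∈ m.primeFactors,
    (indD q d t (ℓ ^ ((n₁ * n₂ * μ).factorization ℓ - 1))
      - indD q d t (ℓ ^ (n₁ * n₂ * μ).factorization ℓ))) *
  ∏ ℓ ∈ n₁.primeFactors \ m.primeFactors, indD q d t (ℓ ^ (n₁ * n₂).factorization ℓ)

/-- The class number `H_{n₁,n₂}(t, q, d)`. Every `μ ≺ m` divides `n₁`, so the inner sum is over all
`μ ≺ m`; the sign is `(-1)` to the number of prime divisors of `m`. -/
noncomputable def classNumberH (n₁ n₂ : ℕ) (t : ℤ) (q : ℕ) (d : ℤ) : ℝ :=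
  open Classical in
  1 / 2 * hurwitzQuot (t ^ 2 - 4 * q) n₂ * deltaMod n₂ (d ^ 2 * q) 1 * indD q d t (n₁ * n₂)
  + ∑ m ∈ n₁.divisors.filter (fun m => IsFullDivisor m n₁ ∧ 2 ≤ m),
      ∑ μ ∈ n₁.divisors.filter (fun μ => Prec n₁ n₂ μ m),
        (-1 : ℝ) ^ m.primeFactors.card * (1 / 2 * hurwitzQuot (t ^ 2 - 4 * q) (n₂ * μ))
          * deltaMod (n₂ * μ) (d ^ 2 * q) 1 * localFactors n₁ n₂ m μ q d t

/-- The supersingular class number `H*_{n₁,n₂}(t, q, d)` for `q = p ^ v`. -/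
noncomputable def classNumberHStar (n₁ n₂ : ℕ) (t : ℤ) (p v : ℕ) (d : ℤ) : ℝ :=
  open Classical in
  if 2 < n₂ then 0
  else if n₂ = 2 then
    if t = 0 then 1 / 2 * weightedClassNumber (-(p : ℤ)) * indD (p ^ v) d t (2 * n₁) else 0
  else if Even v then
    if t = 0 then 1 / 4 * (1 - (kroneckerPrime (-4) p : ℝ)) * indD (p ^ v) d t n₁
    else if t ^ 2 = (p : ℤ) ^ v then
      1 / 6 * (1 - (kroneckerPrime (-3) p : ℝ)) * indD (p ^ v) d t n₁
    else 0
  else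
    if t = 0 then
      1 / 2 * hurwitzClassNumber (-4 * (p : ℤ)) * indD (p ^ v) d t n₁
        - deltaMod 4 n₁ 0 * (1 / 2) * weightedClassNumber (-(p : ℤ))
          * (indD (p ^ v) d t n₁ - indD (p ^ v) d t (2 * n₁))
    else if t ^ 2 = 2 * (p : ℤ) ^ v ∧ p = 2 then 1 / 4 * indD (p ^ v) d t n₁
    else if t ^ 2 = 3 * (p : ℤ) ^ v ∧ p = 3 then 1 / 6 * indD (p ^ v) d t n₁
    else 0

/-! ### The sums over traces -/

/-- The finite set of integers `t` with `t² < 4 q`. -/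
noncomputable def traceRange (q : ℕ) : Finset ℤ :=
  (Finset.Icc (-(2 * q : ℤ)) (2 * q)).filter (fun t => t ^ 2 < 4 * (q : ℤ))

lemma mem_traceRange {q : ℕ} {t : ℤ} : t ∈ traceRange q ↔ t ^ 2 < 4 * (q : ℤ) := by
  simp only [traceRange, Finset.mem_filter, Finset.mem_Icc, and_iff_right_iff_imp]
  intro h
  have hq : (0 : ℤ) ≤ q := Int.natCast_nonneg q
  constructor <;> nlinarith [sq_nonneg ((q : ℤ) - 1)]

/-- `Σ_{n₁,n₂}(q, d) = ∑_{t² < 4q} U_{k-2}(t, q) H_{n₁,n₂}(t, q, d)`. -/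
noncomputable def sigmaSum (k n₁ n₂ q : ℕ) (d : ℤ) : ℝ :=
  ∑ t ∈ traceRange q, normChebyshev (k - 2) t q * classNumberH n₁ n₂ t q d

/-- `Σ_{n₁,n₂}(q / p², d)`, which is `0` if `q / p²` is not an integer. -/
noncomputable def sigmaSumQuot (k n₁ n₂ q p : ℕ) (d : ℤ) : ℝ :=
  open Classical in if p ^ 2 ∣ q then sigmaSum k n₁ n₂ (q / p ^ 2) d else 0

/-- The first invariant factor of a finite abelian group: the largest order of a cyclic
subgroup. -/
noncomputable def invFactorOne (A : Type*) [AddCommGroup A] : ℕ :=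
  sSup {n : ℕ | ∃ a : A, addOrderOf a = n}

/-- The second invariant factor of a finite abelian group of rank at most two, that is, `n₂` in
`A ≃ ℤ/n₁ × ℤ/n₂` with `n₂ ∣ n₁`. Since `|A| = n₁ n₂`, it is `|A| / n₁`. -/
noncomputable def invFactorTwo (A : Type*) [AddCommGroup A] : ℕ :=
  Nat.card A / invFactorOne A

lemma invFactor_eq {A : Type*} [AddCommGroup A] {n₁ n₂ : ℕ} (h₁ : 0 < n₁) (h : n₂ ∣ n₁)
    (e : A ≃+ ZMod n₁ × ZMod n₂) : invFactorOne A = n₁ ∧ invFactorTwo A = n₂ := by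
  have h1 : invFactorOne A = n₁ := by
    refine IsGreatest.csSup_eq ⟨⟨e.symm (1, 0), ?_⟩, ?_⟩
    · rw [AddEquiv.addOrderOf_eq, Prod.addOrderOf_mk, ZMod.addOrderOf_one, addOrderOf_zero,
        Nat.lcm_one_right]
    · rintro n ⟨a, rfl⟩
      refine Nat.le_of_dvd h₁ (addOrderOf_dvd_of_nsmul_eq_zero (e.injective ?_))
      obtain ⟨c, rfl⟩ := h
      rw [map_nsmul, map_zero]
      have hz := CharP.cast_eq_zero (ZMod (n₂ * c)) (n₂ * c)
      push_cast at hz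
      ext <;> simp [hz]
  refine ⟨h1, ?_⟩
  rw [invFactorTwo, h1, Nat.card_congr e.toEquiv, Nat.card_prod, Nat.card_zmod, Nat.card_zmod,
    Nat.mul_div_cancel_left _ h₁]

/-- `ω_A(q, d)` in weight `k`, for `q = p ^ v`. -/
noncomputable def omegaOrd (A : Type*) [AddCommGroup A] (k p v : ℕ) (d : ℤ) : ℝ :=
  open Classical in
  ∑ t ∈ (traceRange (p ^ v)).filter (fun t => ¬ (p : ℤ) ∣ t),
    normChebyshev (k - 2) t (p ^ v) * classNumberH (invFactorOne A) (invFactorTwo A) t (p ^ v) d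

/-- `ω*_A(q, d)` in weight `k`, for `q = p ^ v`. -/
noncomputable def omegaStar (A : Type*) [AddCommGroup A] (k p v : ℕ) (d : ℤ) : ℝ :=
  ∑ t ∈ traceRange (p ^ v),
    normChebyshev (k - 2) t (p ^ v) *
      classNumberHStar (invFactorOne A) (invFactorTwo A) t p v d

/-!
The ordinary traces, those prime to `p`, contribute the same terms to `ω_A(q, 1)` and to
`Σ(q, 1)`, and the sum over `q / p²` is a sum over traces `t = p s` because
`U_{k-2}(p s, q) = p ^ (k - 2) U_{k-2}(s, q / p²)` (`normChebyshev_prime_mul`). So the identity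
follows from a pointwise one for traces divisible by `p`:
`H(p s, q, 1) - p H(s, q / p², p) = H*(p s, q, 1)` (`classNumberH_sub_prime_sq`), where the second
term is absent for `q = p` (`classNumberH_prime`).

The local conditions in `H_{n₁,n₂}` form a linear functional of the function
`n ↦ H((t² - 4q) / n²)` (`classNumberComb`), which is the same for `(s, q / p², p)` and for
`(p s, q, 1)`. So one needs the value of `H(p² E) - p H(E)` for `E = (s² - 4q / p²) / n²` with `n`
prime to `p`. The class number formula `h_w(p² d) = (p - (d / p)) h_w(d)` shows that this
difference does not change if `E` is multiplied by `p²`, and that it is `(1 - (E / p)) H(E)` if `p`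
does not divide the conductor of `E` (`hurwitzQuot_sub_prime_sq_mul`,
`hurwitzQuot_sub_of_kronecker`). Dividing the trace by `p` as long as possible, one ends with a
trace prime to `p`, where `p` splits and the difference is zero, or with one of the discriminants
`-4p`, `-4`, `-3` (`hurwitzQuot_sub_eq_supersingularQuot`). The squares prime to `p` that divide
these are `1` and `4`, which reduces the combination of local conditions to the few terms
that define `H*` (`classNumberComb_supersingularQuot`).

The class number formula (`weightedClassNumber_sq_mul`) is proved for the orders `R = ℤ + pS ⊆ S`
in `ℂ` with the group of invertible lattices in `ℂ` in place of the group of fractional ideals,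
which gives the same class group (`Subalgebra.card_classGroup`). Extension of lattices from `R` to
`S` is surjective: an invertible `S`-module `J` is generated by one element `x` modulo `pJ`, and it
is the extension of `ℤx + pJ` (`Subalgebra.extendUnits_surjective`). Its kernel corresponds to the
lines in `S / pS` that are spanned by units (`IsQuadraticOrder.range_ker`); there are
`p + 1` lines, and the exceptions are counted by the roots modulo `p` of the minimal polynomial of a
generator of `S`. The principal lattices in the kernel come from the units of `S`
(`ncard_unit_classes`). Finiteness of class numbers is not needed.
-/

/-! ### Invertible lattices over subrings of a field -/

section Lattices

variable {K : Type*} [Field K]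

/-- A `ℤ`-submodule of `K` stable under a subring `S`, as an `S`-submodule. -/
def Subalgebra.submoduleOfMulLe (S : Subalgebra ℤ K) (L : Submodule ℤ K)
    (h : S.toSubmodule * L ≤ L) : Submodule S K where
  carrier := L
  add_mem' := L.add_mem
  zero_mem' := L.zero_mem
  smul_mem' c _ hx := h (Submodule.mul_mem_mul c.2 hx)

lemma Subalgebra.toSubmodule_mul_self (S : Subalgebra ℤ K) :
    S.toSubmodule * S.toSubmodule = S.toSubmodule :=
  S.isIdempotentElem_toSubmodule

lemma Subalgebra.one_le_toSubmodule (S : Subalgebra ℤ K) :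
    (1 : Submodule ℤ K) ≤ S.toSubmodule :=
  Submodule.one_le.mpr S.one_mem

lemma Subalgebra.toSubmodule_mul_restrictScalars (S : Subalgebra ℤ K) (I : Submodule S K) :
    S.toSubmodule * I.restrictScalars ℤ = I.restrictScalars ℤ := by
  refine le_antisymm (Submodule.mul_le.mpr fun c hc x hx => ?_) ?_
  · exact I.smul_mem (⟨c, hc⟩ : S) hx
  · conv_lhs => rw [← one_mul (I.restrictScalars ℤ)]
    exact mul_le_mul' S.one_le_toSubmodule le_rfl

lemma Subalgebra.restrictScalars_one_submodule (S : Subalgebra ℤ K) :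
    (1 : Submodule S K).restrictScalars ℤ = S.toSubmodule := by
  ext x
  simp

/-- Extension of invertible modules along an inclusion `R ≤ S` of subrings of a field. -/
noncomputable def Subalgebra.extendUnits {R S : Subalgebra ℤ K} (h : R ≤ S) :
    (Submodule R K)ˣ →* (Submodule S K)ˣ :=
  Units.map
    { toFun := fun I => S.submoduleOfMulLe (S.toSubmodule * I.restrictScalars ℤ) (by
        rw [← mul_assoc, S.toSubmodule_mul_self])
      map_one' := by
        apply Submodule.restrictScalars_injective ℤ
        rw [S.restrictScalars_one_submodule]
        change S.toSubmodule * (1 : Submodule R K).restrictScalars ℤ = _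
        rw [R.restrictScalars_one_submodule]
        refine le_antisymm ((mul_le_mul' le_rfl
          (Subalgebra.toSubmodule.monotone h)).trans S.toSubmodule_mul_self.le) ?_
        conv_lhs => rw [← mul_one S.toSubmodule]
        exact mul_le_mul' le_rfl R.one_le_toSubmodule
      map_mul' := fun I J => by
        apply Submodule.restrictScalars_injective ℤ
        change S.toSubmodule * (I.restrictScalars ℤ * J.restrictScalars ℤ) =
          (S.toSubmodule * I.restrictScalars ℤ) * (S.toSubmodule * J.restrictScalars ℤ)
        conv_lhs => rw [← S.toSubmodule_mul_self]
        ring }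

lemma Subalgebra.restrictScalars_extendUnits {R S : Subalgebra ℤ K} (h : R ≤ S)
    (I : (Submodule R K)ˣ) :
    (Subalgebra.extendUnits h I : Submodule S K).restrictScalars ℤ =
      S.toSubmodule * (I : Submodule R K).restrictScalars ℤ := rfl

/-- The subgroup of principal modules `xS` in the group of invertible `S`-submodules of `K`. -/
noncomputable def Subalgebra.principalUnits (S : Subalgebra ℤ K) : Subgroup (Submodule S K)ˣ :=
  (Units.map (Submodule.spanSingleton (A := K) S).toMonoidHom).range

lemma Subalgebra.restrictScalars_span_singleton (S : Subalgebra ℤ K) (x : K) :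
    (Submodule.span S {x}).restrictScalars ℤ = Submodule.span ℤ {x} * S.toSubmodule := by
  ext z
  rw [Submodule.restrictScalars_mem, Submodule.mem_span_singleton, Submodule.mem_span_singleton_mul]
  constructor
  · rintro ⟨a, rfl⟩
    exact ⟨a, a.2, by rw [mul_comm]; rfl⟩
  · rintro ⟨a, ha, rfl⟩
    exact ⟨⟨a, ha⟩, by rw [mul_comm]; rfl⟩

lemma Subalgebra.mem_principalUnits (S : Subalgebra ℤ K) {I : (Submodule S K)ˣ} :
    I ∈ S.principalUnits ↔ ∃ x : K, x ≠ 0 ∧ (I : Submodule S K).restrictScalars ℤ =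
      Submodule.span ℤ {x} * S.toSubmodule := by
  constructor
  · rintro ⟨x, rfl⟩
    exact ⟨x, x.ne_zero, S.restrictScalars_span_singleton x⟩
  · rintro ⟨x, hx, h⟩
    refine ⟨Units.mk0 x hx, Units.ext (Submodule.restrictScalars_injective ℤ _ _ ?_)⟩
    rw [h]
    exact S.restrictScalars_span_singleton x

/-- The class group of a subring of a field is the group of invertible submodules of the field
modulo the principal ones, even if the field is larger than the field of fractions. -/
lemma Subalgebra.card_classGroup (S : Subalgebra ℤ K) :
    Nat.card (ClassGroup S) = S.principalUnits.index := by
  rw [Nat.card_congr (ClassGroup.equivPic S).toEquiv, Subgroup.index]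
  refine (Nat.card_congr ((Submodule.unitsQuotEquivRelPic S K).trans
    (.trans (.subgroupCongr (CommRing.relPic_eq_top S K)) Subgroup.topEquiv)).toEquiv).symm

lemma Subalgebra.comap_principalUnits {R S : Subalgebra ℤ K} (h : R ≤ S) :
    S.principalUnits.comap (Subalgebra.extendUnits h) =
      R.principalUnits ⊔ (Subalgebra.extendUnits h).ker := by
  have hmap : S.principalUnits = R.principalUnits.map (Subalgebra.extendUnits h) := by
    rw [Subalgebra.principalUnits, Subalgebra.principalUnits, MonoidHom.map_range]
    congr 1
    ext x : 2
    apply Submodule.restrictScalars_injective ℤ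
    refine (S.restrictScalars_span_singleton x).trans ?_
    refine Eq.trans ?_ (congrArg (S.toSubmodule * ·) (R.restrictScalars_span_singleton x)).symm
    have h1 : S.toSubmodule * R.toSubmodule = S.toSubmodule := by
      rw [Subalgebra.mul_toSubmodule, sup_of_le_left h]
    rw [mul_left_comm, h1]
  rw [hmap, Subgroup.comap_map_eq]

/-- Comparison of the class groups of two subrings `R ≤ S` of a field if every invertible
`S`-module is the extension of an invertible `R`-module. -/
lemma Subalgebra.card_classGroup_mul {R S : Subalgebra ℤ K} (h : R ≤ S)
    (hs : Function.Surjective (Subalgebra.extendUnits h)) :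
    Nat.card (ClassGroup R) *
        Nat.card (R.principalUnits ⊓ (Subalgebra.extendUnits h).ker : Subgroup (Submodule R K)ˣ) =
      Nat.card (ClassGroup S) * Nat.card (Subalgebra.extendUnits h).ker := by
  rw [R.card_classGroup, S.card_classGroup, ← Subgroup.index_comap_of_surjective _ hs,
    comap_principalUnits]
  have : R.principalUnits.Normal := ⟨fun n hn g => by rwa [mul_comm g, mul_inv_cancel_right]⟩
  rw [← Subgroup.relIndex_mul_index (le_sup_left : R.principalUnits ≤
    R.principalUnits ⊔ (Subalgebra.extendUnits h).ker), sup_comm, Subgroup.relIndex_sup_right]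
  have := Subgroup.relIndex_inf_mul_relIndex (⊥ : Subgroup (Submodule R K)ˣ) R.principalUnits
    (Subalgebra.extendUnits h).ker
  rw [bot_inf_eq, Subgroup.relIndex_bot_left, Subgroup.relIndex_bot_left] at this
  rw [← this]
  ring

end Lattices

/-! ### Subrings of conductor `p` -/

section Conductor

variable {K : Type*} [Field K]

/-- The lattices `ℤx + pJ` and `ℤy + pJ'` are mutually inverse modules over `R = ℤ + pS`
if `J` and `J'` are mutually inverse `S`-modules and `xy ≡ 1 mod pS`. -/
lemma Subalgebra.span_add_mul_span_add {R S : Subalgebra ℤ K} {P J J' : Submodule ℤ K} {x y : K}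
    (hP : P ≤ S.toSubmodule) (hR : R.toSubmodule = 1 + P * S.toSubmodule)
    (hJ' : S.toSubmodule * J' = J') (hJJ' : J * J' = S.toSubmodule)
    (hx : x ∈ J) (hy : y ∈ J') (hxy : x * y - 1 ∈ P * S.toSubmodule) :
    (Submodule.span ℤ {x} + P * J) * (Submodule.span ℤ {y} + P * J') = R.toSubmodule := by
  set X := Submodule.span ℤ {x} with hX
  set Y := Submodule.span ℤ {y} with hY
  have hXY : X * Y = Submodule.span ℤ {x * y} := by
    rw [hX, hY, Submodule.span_mul_span, Set.singleton_mul_singleton]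
  have hXJ : X ≤ J := by rwa [hX, Submodule.span_singleton_le_iff_mem]
  have hYJ : Y ≤ J' := by rwa [hY, Submodule.span_singleton_le_iff_mem]
  have hexp : (X + P * J) * (Y + P * J') =
      X * Y + P * (X * J') + P * (J * Y) + P * P * (J * J') := by ring
  rw [hexp, hR]
  refine le_antisymm ?_ ?_
  · simp only [Submodule.add_eq_sup]
    refine sup_le (sup_le (sup_le ?_ ?_) ?_) ?_
    · rw [hXY, Submodule.span_singleton_le_iff_mem]
      have : x * y = 1 + (x * y - 1) := by ring
      rw [this]
      exact Submodule.add_mem_sup (Submodule.one_le.mp le_rfl) hxy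
    · exact (mul_le_mul' le_rfl ((mul_le_mul' hXJ le_rfl).trans hJJ'.le)).trans le_sup_right
    · exact (mul_le_mul' le_rfl ((mul_le_mul' le_rfl hYJ).trans hJJ'.le)).trans le_sup_right
    · rw [hJJ', mul_assoc]
      refine le_trans (mul_le_mul' le_rfl ?_) le_sup_right
      exact (mul_le_mul' hP le_rfl).trans S.toSubmodule_mul_self.le
  · have h1 : (1 : Submodule ℤ K) ≤ X * Y + P * S.toSubmodule := by
      rw [Submodule.one_le, hXY]
      have : (1 : K) = x * y + -(x * y - 1) := by ring
      rw [this]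
      exact Submodule.add_mem_sup (Submodule.mem_span_singleton_self _) (Submodule.neg_mem _ hxy)
    have h2 : P * S.toSubmodule ≤ P * (X * J') + P * P * (J * J') := by
      calc P * S.toSubmodule = P * S.toSubmodule * 1 := (mul_one _).symm
        _ ≤ P * S.toSubmodule * (X * Y + P * S.toSubmodule) := mul_le_mul' le_rfl h1
        _ = P * (X * (S.toSubmodule * Y)) + P * P * (S.toSubmodule * S.toSubmodule) := by ring
        _ ≤ P * (X * J') + P * P * (J * J') := by
          refine add_le_add (mul_le_mul' le_rfl (mul_le_mul' le_rfl ?_)) ?_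
          · exact (mul_le_mul' le_rfl hYJ).trans hJ'.le
          · rw [S.toSubmodule_mul_self, hJJ']
    simp only [Submodule.add_eq_sup] at h1 h2 ⊢
    have h3 : P * S.toSubmodule ≤ X * Y ⊔ P * (X * J') ⊔ P * (J * Y) ⊔ P * P * (J * J') :=
      h2.trans (sup_le (le_sup_of_le_left (le_sup_of_le_left le_sup_right)) le_sup_right)
    exact sup_le (h1.trans (sup_le
      (le_sup_of_le_left (le_sup_of_le_left le_sup_left)) h3)) h3

lemma Subalgebra.mul_span_add {S : Subalgebra ℤ K} {P J J' : Submodule ℤ K} {x y : K}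
    (hJ : S.toSubmodule * J = J) (hJJ' : J * J' = S.toSubmodule)
    (hx : x ∈ J) (hy : y ∈ J') (hxy : x * y - 1 ∈ P * S.toSubmodule)
    (hP : P ≤ S.toSubmodule) :
    S.toSubmodule * (Submodule.span ℤ {x} + P * J) = J := by
  set X := Submodule.span ℤ {x} with hX
  set Y := Submodule.span ℤ {y} with hY
  have hXY : X * Y = Submodule.span ℤ {x * y} := by
    rw [hX, hY, Submodule.span_mul_span, Set.singleton_mul_singleton]
  have hXJ : X ≤ J := by rwa [hX, Submodule.span_singleton_le_iff_mem]
  have hYJ : Y ≤ J' := by rwa [hY, Submodule.span_singleton_le_iff_mem]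
  have hexp : S.toSubmodule * (X + P * J) = S.toSubmodule * X + P * (S.toSubmodule * J) := by ring
  rw [hexp, hJ]
  refine le_antisymm ?_ ?_
  · simp only [Submodule.add_eq_sup]
    exact sup_le ((mul_le_mul' le_rfl hXJ).trans hJ.le) ((mul_le_mul' hP le_rfl).trans hJ.le)
  · have h1 : (1 : Submodule ℤ K) ≤ X * Y + P * S.toSubmodule := by
      rw [Submodule.one_le, hXY]
      have : (1 : K) = x * y + -(x * y - 1) := by ring
      rw [this]
      exact Submodule.add_mem_sup (Submodule.mem_span_singleton_self _) (Submodule.neg_mem _ hxy)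
    calc J = J * 1 := (mul_one _).symm
      _ ≤ J * (X * Y + P * S.toSubmodule) := mul_le_mul' le_rfl h1
      _ = (J * Y) * X + P * (S.toSubmodule * J) := by ring
      _ ≤ S.toSubmodule * X + P * J := by
        refine add_le_add (mul_le_mul' ?_ le_rfl) (by rw [hJ])
        exact (mul_le_mul' le_rfl hYJ).trans hJJ'.le

/-- Prime avoidance: an invertible `S`-module `J` has an element `x` such that the ideal `x J⁻¹` of
`S` lies in none of finitely many given maximal ideals. -/
lemma Subalgebra.exists_mul_notMem {S : Subalgebra ℤ K} {J J' : Submodule ℤ K}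
    (hJ : S.toSubmodule * J = J) (hJJ' : J * J' = S.toSubmodule)
    (s : Finset (Ideal S)) (hs : ∀ M ∈ s, M.IsMaximal) :
    ∃ x ∈ J, ∀ M ∈ s, ∃ y ∈ J', ∃ h : x * y ∈ S, (⟨x * y, h⟩ : S) ∉ M := by
  have hmem : ∀ {x y : K}, x ∈ J → y ∈ J' → x * y ∈ S := fun hx hy =>
    hJJ'.le (Submodule.mul_mem_mul hx hy)
  induction s using Finset.induction_on with
  | empty => exact ⟨0, J.zero_mem, by simp⟩
  | insert M s hMs ih =>
    obtain ⟨x, hx, hxs⟩ := ih fun N hN => hs N (Finset.mem_insert_of_mem hN)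
    have hM : M.IsMaximal := hs M (Finset.mem_insert_self _ _)
    by_cases hxM : ∃ y ∈ J', ∃ h : x * y ∈ S, (⟨x * y, h⟩ : S) ∉ M
    · refine ⟨x, hx, fun N hN => ?_⟩
      rcases Finset.mem_insert.mp hN with rfl | hN
      · exact hxM
      · exact hxs N hN
    · push Not at hxM
      obtain ⟨a, ha, y, hy, hay⟩ : ∃ a, ∃ ha : a ∈ J, ∃ y, ∃ hy : y ∈ J',
          (⟨a * y, hmem ha hy⟩ : S) ∉ M := by
        by_contra! hcon
        have hle : S.toSubmodule ≤ (M.restrictScalars ℤ).map (S.val.toLinearMap) := by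
          rw [← hJJ']
          refine Submodule.mul_le.mpr fun a ha y hy => ?_
          exact ⟨⟨a * y, hmem ha hy⟩, hcon a ha y hy, rfl⟩
        obtain ⟨z, hz, hz1⟩ := hle S.one_mem
        have : z = 1 := Subtype.ext hz1
        subst this
        exact hM.ne_top ((Ideal.eq_top_iff_one M).mpr hz)
      obtain ⟨u, hus, huM⟩ : ∃ u : S, (∀ N ∈ s, u ∈ N) ∧ u ∉ M := by
        have hnot : ¬ s.inf id ≤ M := by
          intro hle
          obtain ⟨N, hN, hNM⟩ := (Ideal.IsPrime.inf_le' hM.isPrime).mp hle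
          have := (hs N (Finset.mem_insert_of_mem hN)).eq_of_le hM.ne_top hNM
          exact hMs (this ▸ hN)
        obtain ⟨u, hu, huM⟩ := SetLike.not_le_iff_exists.mp hnot
        exact ⟨u, fun N hN => (Finset.inf_le hN : s.inf id ≤ id N) hu, huM⟩
      have hua : (u : K) * a ∈ J := hJ.le (Submodule.mul_mem_mul u.2 ha)
      refine ⟨x + u * a, J.add_mem hx hua, fun N hN => ?_⟩
      rcases Finset.mem_insert.mp hN with rfl | hN
      · refine ⟨y, hy, hmem (J.add_mem hx hua) hy, fun hcon => ?_⟩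
        have h1 : u * ⟨a * y, hmem ha hy⟩ ∈ N := by
          have h2 := N.sub_mem hcon (hxM y hy (hmem hx hy))
          convert h2 using 1
          apply Subtype.ext
          push_cast
          ring
        exact (hM.isPrime.mem_or_mem h1).elim huM hay
      · obtain ⟨z, hz, hxz, hzN⟩ := hxs N hN
        refine ⟨z, hz, hmem (J.add_mem hx hua) hz, fun hcon => hzN ?_⟩
        have h2 := N.sub_mem hcon (N.mul_mem_right ⟨a * z, hmem ha hz⟩ (hus N hN))
        convert h2 using 1
        apply Subtype.ext
        push_cast
        ring

/-- An invertible module over `S` is locally principal at an integer `p` with `S / p` finite. -/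
lemma Subalgebra.exists_mul_sub_one_mem {S : Subalgebra ℤ K} {J J' : Submodule ℤ K} (p : ℕ)
    [Finite (S ⧸ Ideal.span {(p : S)})]
    (hJ : S.toSubmodule * J = J) (hJ' : S.toSubmodule * J' = J') (hJJ' : J * J' = S.toSubmodule) :
    ∃ x ∈ J, ∃ y ∈ J', x * y - 1 ∈ Submodule.span ℤ {(p : K)} * S.toSubmodule := by
  have hfin : {M : Ideal S | M.IsMaximal ∧ Ideal.span {(p : S)} ≤ M}.Finite := by
    have : Finite (Ideal (S ⧸ Ideal.span {(p : S)})) :=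
      Finite.of_injective (fun I => (I : Set (S ⧸ Ideal.span {(p : S)}))) SetLike.coe_injective
    refine (Set.finite_range (fun I : Ideal (S ⧸ Ideal.span {(p : S)}) =>
      I.comap (Ideal.Quotient.mk _))).subset ?_
    rintro M ⟨-, hM⟩
    exact ⟨M.map (Ideal.Quotient.mk _), by
      simp [Ideal.comap_map_of_surjective' _ Ideal.Quotient.mk_surjective, hM]⟩
  obtain ⟨x, hx, hxM⟩ := Subalgebra.exists_mul_notMem hJ hJJ' hfin.toFinset
    (fun M hM => ((Set.Finite.mem_toFinset _).mp hM).1)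
  let I : Ideal S :=
    { carrier := {s | ∃ y ∈ J', (s : K) = x * y}
      add_mem' := by
        rintro a b ⟨y, hy, hya⟩ ⟨z, hz, hzb⟩
        exact ⟨y + z, J'.add_mem hy hz, by push_cast; rw [hya, hzb]; ring⟩
      zero_mem' := ⟨0, J'.zero_mem, by simp⟩
      smul_mem' := by
        rintro c a ⟨y, hy, hya⟩
        refine ⟨c * y, hJ'.le (Submodule.mul_mem_mul c.2 hy), ?_⟩
        rw [smul_eq_mul]
        push_cast
        rw [hya]
        ring }
  have htop : I ⊔ Ideal.span {(p : S)} = ⊤ := by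
    by_contra hne
    obtain ⟨M, hM, hle⟩ := Ideal.exists_le_maximal _ hne
    obtain ⟨y, hy, hxy, hyM⟩ := hxM M
      ((Set.Finite.mem_toFinset _).mpr ⟨hM, le_sup_right.trans hle⟩)
    exact hyM (hle (Ideal.mem_sup_left ⟨y, hy, rfl⟩))
  have h1 : (1 : S) ∈ I ⊔ Ideal.span {(p : S)} := htop ▸ Submodule.mem_top
  obtain ⟨a, ⟨y, hy, hya⟩, b, hb, hab⟩ := Submodule.mem_sup.mp h1
  obtain ⟨c, rfl⟩ := Ideal.mem_span_singleton'.mp hb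
  refine ⟨x, hx, y, hy, ?_⟩
  rw [Submodule.mem_span_singleton_mul]
  refine ⟨-c, S.neg_mem c.2, ?_⟩
  have h2 := congrArg (Subtype.val) hab
  push_cast at h2
  rw [hya] at h2
  linear_combination -h2

/-- A pair of mutually inverse stable lattices, as an invertible module. -/
noncomputable def Subalgebra.unitOfMulEq (S : Subalgebra ℤ K) (L L' : Submodule ℤ K)
    (h : S.toSubmodule * L ≤ L) (h' : S.toSubmodule * L' ≤ L') (hLL' : L * L' = S.toSubmodule) :
    (Submodule S K)ˣ where
  val := S.submoduleOfMulLe L h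
  inv := S.submoduleOfMulLe L' h'
  val_inv := Submodule.restrictScalars_injective ℤ _ _
    (hLL'.trans S.restrictScalars_one_submodule.symm)
  inv_val := Submodule.restrictScalars_injective ℤ _ _
    ((mul_comm L' L).trans (hLL'.trans S.restrictScalars_one_submodule.symm))

lemma Subalgebra.restrictScalars_unitOfMulEq (S : Subalgebra ℤ K) {L L' : Submodule ℤ K}
    (h : S.toSubmodule * L ≤ L) (h' : S.toSubmodule * L' ≤ L') (hLL' : L * L' = S.toSubmodule) :
    (S.unitOfMulEq L L' h h' hLL' : Submodule S K).restrictScalars ℤ = L := rfl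

lemma Subalgebra.mul_span_add_le {R S : Subalgebra ℤ K} {P J : Submodule ℤ K} {x : K}
    (hP : P ≤ S.toSubmodule) (hR : R.toSubmodule = 1 + P * S.toSubmodule)
    (hJ : S.toSubmodule * J = J) (hx : x ∈ J) :
    R.toSubmodule * (Submodule.span ℤ {x} + P * J) ≤ Submodule.span ℤ {x} + P * J := by
  set X := Submodule.span ℤ {x} with hX
  have hXJ : X ≤ J := by rwa [hX, Submodule.span_singleton_le_iff_mem]
  have hexp : (1 + P * S.toSubmodule) * (X + P * J) =
      X + P * J + P * (S.toSubmodule * X) + P * (P * (S.toSubmodule * J)) := by ring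
  rw [hR, hexp, hJ]
  simp only [Submodule.add_eq_sup]
  refine sup_le (sup_le le_rfl ?_) ?_
  · exact le_sup_of_le_right (mul_le_mul' le_rfl ((mul_le_mul' le_rfl hXJ).trans hJ.le))
  · exact le_sup_of_le_right (mul_le_mul' le_rfl ((mul_le_mul' hP le_rfl).trans hJ.le))

lemma Subalgebra.unit_mul_inv_restrictScalars (S : Subalgebra ℤ K) (I : (Submodule S K)ˣ) :
    (I : Submodule S K).restrictScalars ℤ *
      ((I⁻¹ : (Submodule S K)ˣ) : Submodule S K).restrictScalars ℤ = S.toSubmodule := by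
  rw [← S.restrictScalars_one_submodule, ← Units.mul_inv I]
  rfl

lemma Subalgebra.extendUnits_surjective {R S : Subalgebra ℤ K} (h : R ≤ S) (p : ℕ)
    [Finite (S ⧸ Ideal.span {(p : S)})]
    (hR : R.toSubmodule = 1 + Submodule.span ℤ {(p : K)} * S.toSubmodule) :
    Function.Surjective (Subalgebra.extendUnits h) := by
  intro I
  have hP : Submodule.span ℤ {(p : K)} ≤ S.toSubmodule := by
    rw [Submodule.span_singleton_le_iff_mem]
    exact natCast_mem S p
  have hJ := S.toSubmodule_mul_restrictScalars (I : Submodule S K)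
  have hJ' := S.toSubmodule_mul_restrictScalars ((I⁻¹ : (Submodule S K)ˣ) : Submodule S K)
  have hJJ' := S.unit_mul_inv_restrictScalars I
  obtain ⟨x, hx, y, hy, hxy⟩ := Subalgebra.exists_mul_sub_one_mem p hJ hJ' hJJ'
  refine ⟨R.unitOfMulEq _ _ (Subalgebra.mul_span_add_le hP hR hJ hx)
    (Subalgebra.mul_span_add_le hP hR hJ' hy)
    (Subalgebra.span_add_mul_span_add hP hR hJ' hJJ' hx hy hxy), Units.ext ?_⟩
  exact Submodule.restrictScalars_injective ℤ _ _ (Subalgebra.mul_span_add hJ hJJ' hx hy hxy hP)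

end Conductor

/-! ### The kernel of the extension map for quadratic orders -/

/-- A subring `S` of a field is the quadratic order `ℤ ⊕ ℤτ` with `τ² = bτ - c`. -/
structure IsQuadraticOrder {K : Type*} [Field K] (S : Subalgebra ℤ K) (τ : K) (b c : ℤ) : Prop where
  mem_iff : ∀ z, z ∈ S ↔ ∃ x y : ℤ, z = x + y * τ
  sq_eq : τ ^ 2 = b * τ - c
  eq_zero : ∀ x y : ℤ, (x + y * τ : K) = 0 → x = 0 ∧ y = 0

namespace IsQuadraticOrder

variable {K : Type*} [Field K] {S R : Subalgebra ℤ K} {τ : K} {b c : ℤ}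

lemma ext_coord (hS : IsQuadraticOrder S τ b c) {x y x' y' : ℤ}
    (h : (x + y * τ : K) = x' + y' * τ) : x = x' ∧ y = y' := by
  have := hS.eq_zero (x - x') (y - y') (by push_cast; linear_combination h)
  omega

lemma mem (hS : IsQuadraticOrder S τ b c) (x y : ℤ) : (x + y * τ : K) ∈ S :=
  (hS.mem_iff _).mpr ⟨x, y, rfl⟩

lemma mem_toSubmodule (hS : IsQuadraticOrder S τ b c) (x y : ℤ) :
    (x + y * τ : K) ∈ S.toSubmodule :=
  hS.mem x y

lemma mem_span_natCast_mul (hS : IsQuadraticOrder S τ b c) {p : ℕ} {z : K} :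
    z ∈ Submodule.span ℤ {(p : K)} * S.toSubmodule ↔ ∃ x y : ℤ, z = p * x + p * y * τ := by
  rw [Submodule.mem_span_singleton_mul]
  constructor
  · rintro ⟨w, hw, rfl⟩
    obtain ⟨x, y, rfl⟩ := (hS.mem_iff w).mp hw
    exact ⟨x, y, by ring⟩
  · rintro ⟨x, y, rfl⟩
    exact ⟨x + y * τ, hS.mem x y, by ring⟩

lemma natCast_mul_mem (hS : IsQuadraticOrder S τ b c) (p : ℕ) (x y : ℤ) :
    (p * x + p * y * τ : K) ∈ Submodule.span ℤ {(p : K)} * S.toSubmodule :=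
  hS.mem_span_natCast_mul.mpr ⟨x, y, rfl⟩

lemma finite_quotient (hS : IsQuadraticOrder S τ b c) {p : ℕ} (hp : p ≠ 0) :
    Finite (S ⧸ Ideal.span {(p : S)}) := by
  have : NeZero p := ⟨hp⟩
  let f : ZMod p × ZMod p → S ⧸ Ideal.span {(p : S)} := fun v =>
    Ideal.Quotient.mk _ ⟨(v.1.val : ℤ) + (v.2.val : ℤ) * τ, hS.mem _ _⟩
  refine Finite.of_surjective f fun w => ?_
  obtain ⟨⟨z, hz⟩, rfl⟩ := Ideal.Quotient.mk_surjective w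
  obtain ⟨x, y, rfl⟩ := (hS.mem_iff z).mp hz
  refine ⟨(x, y), Ideal.Quotient.eq.mpr (Ideal.mem_span_singleton'.mpr ?_)⟩
  have h1 : ∀ x : ℤ, ∃ k : ℤ, (((x : ZMod p).val : ℕ) : ℤ) = x + k * p := fun x => by
    rw [ZMod.val_intCast]
    exact ⟨-(x / p), by linarith [Int.emod_add_mul_ediv x p]⟩
  obtain ⟨k, hk⟩ := h1 x
  obtain ⟨l, hl⟩ := h1 y
  refine ⟨⟨k + l * τ, hS.mem _ _⟩, Subtype.ext ?_⟩
  push_cast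
  have hk' := congrArg (Int.cast : ℤ → K) hk
  have hl' := congrArg (Int.cast : ℤ → K) hl
  push_cast at hk' hl'
  rw [hk', hl']
  ring

lemma mem_one_add_span (hS : IsQuadraticOrder S τ b c) {p : ℕ} {z : K} :
    z ∈ 1 + Submodule.span ℤ {(p : K)} * S.toSubmodule ↔ ∃ x y : ℤ, z = x + p * y * τ := by
  rw [Submodule.add_eq_sup, Submodule.mem_sup]
  constructor
  · rintro ⟨u, hu, v, hv, rfl⟩
    obtain ⟨n, rfl⟩ := Submodule.mem_one.mp hu
    obtain ⟨x, y, rfl⟩ := hS.mem_span_natCast_mul.mp hv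
    exact ⟨n + p * x, y, by simp; ring⟩
  · rintro ⟨x, y, rfl⟩
    exact ⟨x, Submodule.mem_one.mpr ⟨x, by simp⟩, _, hS.natCast_mul_mem p 0 y, by simp⟩

lemma mem_conductor (hS : IsQuadraticOrder S τ b c) {p : ℕ}
    (hR : R.toSubmodule = 1 + Submodule.span ℤ {(p : K)} * S.toSubmodule) {z : K} :
    z ∈ R.toSubmodule ↔ ∃ x y : ℤ, z = x + p * y * τ := by
  rw [hR, hS.mem_one_add_span]

lemma mem_span_sub_add (hS : IsQuadraticOrder S τ b c) {p : ℕ} {a : ℤ} {z : K} :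
    z ∈ Submodule.span ℤ {τ - a} + Submodule.span ℤ {(p : K)} * S.toSubmodule ↔
      ∃ x y : ℤ, z = x + y * τ ∧ (p : ℤ) ∣ x + a * y := by
  rw [Submodule.add_eq_sup, Submodule.mem_sup]
  constructor
  · rintro ⟨u, hu, v, hv, rfl⟩
    obtain ⟨n, rfl⟩ := Submodule.mem_span_singleton.mp hu
    obtain ⟨x, y, rfl⟩ := hS.mem_span_natCast_mul.mp hv
    refine ⟨p * x - n * a, n + p * y, ?_, ⟨x + a * y, by ring⟩⟩
    rw [zsmul_eq_mul]
    push_cast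
    ring
  · rintro ⟨x, y, rfl, k, hk⟩
    refine ⟨y • (τ - a), Submodule.smul_mem _ _ (Submodule.mem_span_singleton_self _), _,
      hS.natCast_mul_mem p k 0, ?_⟩
    have := congrArg (Int.cast : ℤ → K) hk
    push_cast at this
    rw [zsmul_eq_mul]
    push_cast
    linear_combination -this

lemma le_of_conductor {p : ℕ}
    (hR : R.toSubmodule = 1 + Submodule.span ℤ {(p : K)} * S.toSubmodule) : R ≤ S := by
  have : R.toSubmodule ≤ S.toSubmodule := by
    rw [hR, Submodule.add_eq_sup]
    refine sup_le S.one_le_toSubmodule ?_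
    refine le_trans (mul_le_mul' ?_ le_rfl) S.toSubmodule_mul_self.le
    rw [Submodule.span_singleton_le_iff_mem]
    exact natCast_mem S p
  exact this

/-- The lattices whose extension to `S` is `S` and that are invertible over `R = ℤ + pS` are `R`
and `ℤ(τ - a) + pS` for the residues `a` modulo `p` such that the norm of `τ - a` is prime to `p`:
they correspond to the lines in `S / pS` that are spanned by units. -/
lemma range_ker (hS : IsQuadraticOrder S τ b c) {p : ℕ} [hp : Fact p.Prime] (h : R ≤ S)
    (hR : R.toSubmodule = 1 + Submodule.span ℤ {(p : K)} * S.toSubmodule) :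
    Set.range (fun I : (Subalgebra.extendUnits h).ker =>
        ((I : (Submodule R K)ˣ) : Submodule R K).restrictScalars ℤ) =
      insert R.toSubmodule ((fun a : ZMod p =>
        Submodule.span ℤ {τ - (a.val : ℤ)} + Submodule.span ℤ {(p : K)} * S.toSubmodule) ''
          {a | ¬ a ^ 2 - b * a + c = 0}) := by
  have hP : Submodule.span ℤ {(p : K)} ≤ S.toSubmodule := by
    rw [Submodule.span_singleton_le_iff_mem]
    exact natCast_mem S p
  have hpp : Prime (p : ℤ) := Nat.prime_iff_prime_int.mp hp.out
  have hp1 : ¬ (p : ℤ) ∣ 1 := hpp.not_dvd_one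
  have hker : ∀ I : (Submodule R K)ˣ, I ∈ (Subalgebra.extendUnits h).ker ↔
      S.toSubmodule * (I : Submodule R K).restrictScalars ℤ = S.toSubmodule := by
    intro I
    rw [MonoidHom.mem_ker, ← Units.val_inj, ← (Submodule.restrictScalars_injective ℤ S K).eq_iff,
      Subalgebra.restrictScalars_extendUnits, Units.val_one, S.restrictScalars_one_submodule]
  have hbridge : ∀ a : ℤ, ((a : ZMod p) ^ 2 - b * a + c = 0) ↔ (p : ℤ) ∣ a ^ 2 - b * a + c := by
    intro a
    rw [← ZMod.intCast_zmod_eq_zero_iff_dvd]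
    push_cast
    rfl
  have hval : ∀ a : ZMod p, (((a.val : ℤ) : ZMod p)) = a := fun a => by simp
  ext L
  constructor
  · rintro ⟨⟨I, hI⟩, rfl⟩
    rw [hker] at hI
    change (I : Submodule R K).restrictScalars ℤ ∈ _
    have hRI := R.toSubmodule_mul_restrictScalars (I : Submodule R K)
    have hII := R.unit_mul_inv_restrictScalars I
    set L := (I : Submodule R K).restrictScalars ℤ with hL
    set L' := ((I⁻¹ : (Submodule R K)ˣ) : Submodule R K).restrictScalars ℤ with hL'
    have hLS : L ≤ S.toSubmodule := by
      rw [← hI]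
      conv_lhs => rw [← one_mul L]
      exact mul_le_mul' S.one_le_toSubmodule le_rfl
    have hPL : Submodule.span ℤ {(p : K)} * S.toSubmodule ≤ L := by
      calc Submodule.span ℤ {(p : K)} * S.toSubmodule
          = Submodule.span ℤ {(p : K)} * S.toSubmodule * L := by rw [mul_assoc, hI]
        _ ≤ R.toSubmodule * L := mul_le_mul' (by rw [hR, Submodule.add_eq_sup]; exact le_sup_right)
            le_rfl
        _ = L := hRI
    have hPmem : ∀ x y : ℤ, (p * x + p * y * τ : K) ∈ L := fun x y => hPL (hS.natCast_mul_mem p x y)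
    have h1of : ∀ x : ℤ, ¬ (p : ℤ) ∣ x → (x : K) ∈ L → (1 : K) ∈ L := by
      intro x hx hxL
      obtain ⟨u, v, huv⟩ := (hpp.coprime_iff_not_dvd.mpr hx)
      have h2 := L.add_mem (hPmem u 0) (L.smul_mem v hxL)
      have h3 := congrArg (Int.cast : ℤ → K) huv
      push_cast at h3
      convert h2 using 1
      rw [zsmul_eq_mul, ← h3]
      push_cast
      ring
    have hnotS : L ≠ S.toSubmodule := by
      intro hcon
      have h2 : S.toSubmodule * R.toSubmodule = R.toSubmodule := by
        rw [← hII, ← mul_assoc, hcon, S.toSubmodule_mul_self]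
      have h3 : τ ∈ R.toSubmodule := by
        rw [← h2, ← mul_one τ]
        refine Submodule.mul_mem_mul ?_ R.one_mem
        have := hS.mem 0 1
        simpa using this
      obtain ⟨x, y, hxy⟩ := (hS.mem_conductor hR).mp h3
      have h4 := hS.ext_coord (x := 0) (y := 1) (x' := x) (y' := p * y)
        (by push_cast at hxy ⊢; linear_combination hxy)
      exact hp1 ⟨y, h4.2⟩
    by_cases hall : ∀ x y : ℤ, (x + y * τ : K) ∈ L → (p : ℤ) ∣ y
    · left
      have h1 : (1 : K) ∈ L := by
        by_contra h1
        have hle : L ≤ Submodule.span ℤ {(p : K)} * S.toSubmodule := by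
          intro z hz
          obtain ⟨x, y, rfl⟩ := (hS.mem_iff z).mp (hLS hz)
          obtain ⟨y', rfl⟩ := hall x y hz
          by_cases hx : (p : ℤ) ∣ x
          · obtain ⟨x', rfl⟩ := hx
            convert hS.natCast_mul_mem p x' y' using 1
            push_cast
            ring
          · refine absurd (h1of x hx ?_) h1
            convert L.sub_mem hz (hPmem 0 y') using 1
            push_cast
            ring
        have h2 : S.toSubmodule ≤ Submodule.span ℤ {(p : K)} * S.toSubmodule := by
          calc S.toSubmodule = S.toSubmodule * L := hI.symm
            _ ≤ S.toSubmodule * (Submodule.span ℤ {(p : K)} * S.toSubmodule) :=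
                mul_le_mul' le_rfl hle
            _ = _ := by rw [mul_left_comm, S.toSubmodule_mul_self]
        obtain ⟨x, y, hxy⟩ := hS.mem_span_natCast_mul.mp (h2 S.one_mem)
        have h4 := hS.ext_coord (x := 1) (y := 0) (x' := p * x) (y' := p * y)
          (by push_cast at hxy ⊢; linear_combination hxy)
        exact hp1 ⟨x, h4.1⟩
      refine le_antisymm ?_ ?_
      · intro z hz
        obtain ⟨x, y, rfl⟩ := (hS.mem_iff z).mp (hLS hz)
        obtain ⟨y', rfl⟩ := hall x y hz
        exact (hS.mem_conductor hR).mpr ⟨x, y', by push_cast; ring⟩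
      · rw [hR, Submodule.add_eq_sup]
        exact sup_le (Submodule.one_le.mpr h1) hPL
    · right
      push Not at hall
      obtain ⟨x, y, hxy, hy⟩ := hall
      -- scale to an element of `L` of the form `τ - a`
      obtain ⟨a, ha⟩ : ∃ a : ℤ, (τ - a : K) ∈ L := by
        obtain ⟨u, v, huv⟩ := (hpp.coprime_iff_not_dvd.mpr hy)
        refine ⟨-(v * x), ?_⟩
        have h2 := L.add_mem (hPmem 0 u) (L.smul_mem v hxy)
        have h3 := congrArg (Int.cast : ℤ → K) huv
        push_cast at h3
        convert h2 using 1
        rw [zsmul_eq_mul]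
        push_cast
        linear_combination (-τ) * h3
      have ha' : (τ - ((a : ZMod p).val : ℤ) : K) ∈ L := by
        have h2 := L.add_mem ha (hPmem (a / p) 0)
        convert h2 using 1
        rw [ZMod.val_intCast]
        have h3 := congrArg (Int.cast : ℤ → K) (Int.emod_add_mul_ediv a p)
        push_cast at h3 ⊢
        linear_combination -h3
      generalize (a : ZMod p) = a at ha'
      have h1 : (1 : K) ∉ L := by
        intro h1
        refine hnotS (le_antisymm hLS fun z hz => ?_)
        obtain ⟨x, y, rfl⟩ := (hS.mem_iff z).mp hz
        have h2 := L.add_mem (L.smul_mem (x + y * (a.val : ℤ)) h1) (L.smul_mem y ha')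
        convert h2 using 1
        rw [zsmul_eq_mul, zsmul_eq_mul]
        push_cast
        ring
      have hLa : Submodule.span ℤ {τ - (a.val : ℤ)} + Submodule.span ℤ {(p : K)} * S.toSubmodule
          = L := by
        refine le_antisymm ?_ ?_
        · rw [Submodule.add_eq_sup]
          exact sup_le ((Submodule.span_singleton_le_iff_mem _ _).mpr ha') hPL
        · intro z hz
          obtain ⟨x, y, rfl⟩ := (hS.mem_iff z).mp (hLS hz)
          refine hS.mem_span_sub_add.mpr ⟨x, y, rfl, ?_⟩
          by_contra hcon
          refine h1 (h1of _ hcon ?_)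
          have h2 := L.sub_mem hz (L.smul_mem y ha')
          convert h2 using 1
          rw [zsmul_eq_mul]
          push_cast
          ring
      refine ⟨a, fun hroot => ?_, hLa⟩
      rw [← hval a, hbridge] at hroot
      -- otherwise the conjugate of `τ - a` multiplies `S = S L` into `pS`
      obtain ⟨n, hn⟩ := hroot
      have hconj : (b - τ - (a.val : ℤ) : K) ∈ S.toSubmodule := by
        convert hS.mem_toSubmodule (b - a.val) (-1) using 1
        push_cast
        ring
      have hprod : Submodule.span ℤ {(b - τ - (a.val : ℤ) : K)} * S.toSubmodule ≤
          Submodule.span ℤ {(p : K)} * S.toSubmodule := by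
        rw [← hI, mul_left_comm, ← hLa, mul_add, Submodule.span_mul_span,
          Set.singleton_mul_singleton, Submodule.add_eq_sup]
        have hbase : Submodule.span ℤ {(b - τ - (a.val : ℤ) : K) * (τ - (a.val : ℤ))} ⊔
            Submodule.span ℤ {(b - τ - (a.val : ℤ) : K)} *
              (Submodule.span ℤ {(p : K)} * S.toSubmodule) ≤
              Submodule.span ℤ {(p : K)} * S.toSubmodule := by
          refine sup_le ?_ ?_
          · rw [Submodule.span_singleton_le_iff_mem]
            convert hS.natCast_mul_mem p n 0 using 1
            have h3 := congrArg (Int.cast : ℤ → K) hn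
            push_cast at h3 ⊢
            linear_combination h3 - hS.sq_eq
          · rw [mul_left_comm]
            refine mul_le_mul' le_rfl (le_trans (mul_le_mul' ?_ le_rfl) S.toSubmodule_mul_self.le)
            exact (Submodule.span_singleton_le_iff_mem _ _).mpr hconj
        refine (mul_le_mul' le_rfl hbase).trans ?_
        rw [mul_left_comm, S.toSubmodule_mul_self, hLa, hI]
      have h2 : (b - τ - (a.val : ℤ) : K) ∈ Submodule.span ℤ {(p : K)} * S.toSubmodule := by
        refine hprod ?_
        have h3 := Submodule.mul_mem_mul
          (Submodule.mem_span_singleton_self (R := ℤ) (b - τ - (a.val : ℤ) : K))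
          (Submodule.one_le.mp S.one_le_toSubmodule)
        rwa [mul_one] at h3
      obtain ⟨x, y, hxy⟩ := hS.mem_span_natCast_mul.mp h2
      have h4 := hS.ext_coord (x := b - a.val) (y := -1) (x' := p * x) (y' := p * y)
        (by push_cast at hxy ⊢; linear_combination hxy)
      exact hp1 ⟨-y, by linarith [h4.2]⟩
  · rintro (rfl | ⟨a, ha, rfl⟩)
    · refine ⟨1, ?_⟩
      exact R.restrictScalars_one_submodule
    · change ¬ _ at ha
      rw [← hval a, hbridge] at ha
      obtain ⟨u, v, huv⟩ := hpp.coprime_iff_not_dvd.mpr ha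
      have hx : (τ - (a.val : ℤ) : K) ∈ S.toSubmodule := by
        convert hS.mem_toSubmodule (-a.val) 1 using 1
        push_cast
        ring
      have hy : (v * (b - τ - (a.val : ℤ)) : K) ∈ S.toSubmodule := by
        convert hS.mem_toSubmodule (v * (b - a.val)) (-v) using 1
        push_cast
        ring
      have hxy : (τ - (a.val : ℤ) : K) * (v * (b - τ - (a.val : ℤ))) - 1 ∈
          Submodule.span ℤ {(p : K)} * S.toSubmodule := by
        convert hS.natCast_mul_mem p (-u) 0 using 1
        have h3 := congrArg (Int.cast : ℤ → K) huv
        push_cast at h3 ⊢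
        linear_combination h3 - v * hS.sq_eq
      have hSS := S.toSubmodule_mul_self
      refine ⟨⟨R.unitOfMulEq _ _ (Subalgebra.mul_span_add_le hP hR hSS hx)
        (Subalgebra.mul_span_add_le hP hR hSS hy)
        (Subalgebra.span_add_mul_span_add hP hR hSS hSS hx hy hxy), ?_⟩, rfl⟩
      rw [hker]
      exact Subalgebra.mul_span_add hSS hSS hx hy hxy hP

lemma card_ker (hS : IsQuadraticOrder S τ b c) {p : ℕ} [hp : Fact p.Prime] (h : R ≤ S)
    (hR : R.toSubmodule = 1 + Submodule.span ℤ {(p : K)} * S.toSubmodule) :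
    Nat.card (Subalgebra.extendUnits h).ker + {a : ZMod p | a ^ 2 - b * a + c = 0}.ncard =
      p + 1 := by
  have hp1 : ¬ (p : ℤ) ∣ 1 := (Nat.prime_iff_prime_int.mp hp.out).not_dvd_one
  have hinj : Function.Injective (fun I : (Subalgebra.extendUnits h).ker =>
      ((I : (Submodule R K)ˣ) : Submodule R K).restrictScalars ℤ) := fun I J hIJ =>
    Subtype.ext (Units.ext (Submodule.restrictScalars_injective ℤ _ _ hIJ))
  rw [← Set.ncard_range_of_injective hinj, hS.range_ker h hR, Set.ncard_insert_of_notMem,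
    Set.ncard_image_of_injective]
  · have h1 := Set.ncard_add_ncard_compl {a : ZMod p | a ^ 2 - b * a + c = 0}
    rw [Nat.card_zmod] at h1
    have h2 : {a : ZMod p | a ^ 2 - b * a + c = 0}ᶜ = {a : ZMod p | ¬ a ^ 2 - b * a + c = 0} := rfl
    rw [h2] at h1
    omega
  · intro a a' haa
    have h1 : (τ - (a.val : ℤ) : K) ∈ Submodule.span ℤ {τ - (a'.val : ℤ)} +
        Submodule.span ℤ {(p : K)} * S.toSubmodule := by
      rw [← show Submodule.span ℤ {τ - (a.val : ℤ)} + _ = Submodule.span ℤ {τ - (a'.val : ℤ)} + _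
        from haa]
      exact hS.mem_span_sub_add.mpr ⟨-a.val, 1, by push_cast; ring, by simp⟩
    obtain ⟨x, y, hxy, hd⟩ := hS.mem_span_sub_add.mp h1
    have h4 := hS.ext_coord (x := -a.val) (y := 1) (x' := x) (y' := y)
      (by push_cast at hxy ⊢; linear_combination hxy)
    rw [← h4.1, ← h4.2, ← ZMod.intCast_zmod_eq_zero_iff_dvd] at hd
    push_cast at hd
    simp only [ZMod.natCast_val, ZMod.cast_id', id] at hd
    linear_combination -hd
  · rintro ⟨a, -, ha⟩
    have h1 : (1 : K) ∈ Submodule.span ℤ {τ - (a.val : ℤ)} +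
        Submodule.span ℤ {(p : K)} * S.toSubmodule := by
      rw [show Submodule.span ℤ {τ - (a.val : ℤ)} + _ = R.toSubmodule from ha]
      exact R.one_mem
    obtain ⟨x, y, hxy, hd⟩ := hS.mem_span_sub_add.mp h1
    have h4 := hS.ext_coord (x := 1) (y := 0) (x' := x) (y' := y)
      (by push_cast at hxy ⊢; linear_combination hxy)
    rw [← h4.1, ← h4.2] at hd
    simp only [mul_zero, add_zero] at hd
    exact hp1 hd

end IsQuadraticOrder

/-! ### Principal lattices in the kernel of the extension map -/

section UnitClasses

variable {K : Type*} [Field K]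

lemma Submodule.span_singleton_neg_eq (x : K) :
    Submodule.span ℤ {-x} = Submodule.span ℤ {x} := by
  rw [← Set.neg_singleton, Submodule.span_neg]

lemma Subalgebra.exists_mul_of_span_mul_eq {R : Subalgebra ℤ K} {x y : K}
    (h : Submodule.span ℤ {x} * R.toSubmodule = Submodule.span ℤ {y} * R.toSubmodule) :
    ∃ r ∈ R, y = x * r := by
  have h1 : y ∈ Submodule.span ℤ {y} * R.toSubmodule := by
    have h2 := Submodule.mul_mem_mul (Submodule.mem_span_singleton_self (R := ℤ) y)
      (Submodule.one_le.mp R.one_le_toSubmodule)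
    rwa [mul_one] at h2
  rw [← h, Submodule.mem_span_singleton_mul] at h1
  obtain ⟨r, hr, hxr⟩ := h1
  exact ⟨r, hr, hxr.symm⟩

/-- The principal modules in the kernel of the extension map are the `uR` with `u` a unit
of `S`. -/
lemma Subalgebra.card_principalUnits_inf_ker {R S : Subalgebra ℤ K} (h : R ≤ S) :
    Nat.card (R.principalUnits ⊓ (Subalgebra.extendUnits h).ker : Subgroup (Submodule R K)ˣ) =
      {L : Submodule ℤ K | ∃ x ∈ S, ∃ s ∈ S, x * s = 1 ∧
        L = Submodule.span ℤ {x} * R.toSubmodule}.ncard := by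
  have hSR : S.toSubmodule * R.toSubmodule = S.toSubmodule := by
    rw [Subalgebra.mul_toSubmodule, sup_of_le_left h]
  have hinj : Function.Injective (fun I : (R.principalUnits ⊓ (Subalgebra.extendUnits h).ker :
      Subgroup (Submodule R K)ˣ) => ((I : (Submodule R K)ˣ) : Submodule R K).restrictScalars ℤ) :=
    fun I J hIJ => Subtype.ext (Units.ext (Submodule.restrictScalars_injective ℤ _ _ hIJ))
  rw [← Set.ncard_range_of_injective hinj]
  congr 1
  ext L
  have hker : ∀ I : (Submodule R K)ˣ, I ∈ (Subalgebra.extendUnits h).ker ↔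
      S.toSubmodule * (I : Submodule R K).restrictScalars ℤ = S.toSubmodule := by
    intro I
    rw [MonoidHom.mem_ker, ← Units.val_inj, ← (Submodule.restrictScalars_injective ℤ S K).eq_iff,
      Subalgebra.restrictScalars_extendUnits, Units.val_one, S.restrictScalars_one_submodule]
  constructor
  · rintro ⟨⟨I, hI, hI'⟩, rfl⟩
    obtain ⟨x, hx, hIx⟩ := R.mem_principalUnits.mp hI
    replace hI' := (hker I).mp hI'
    rw [hIx, mul_left_comm, hSR] at hI'
    have h1 : (1 : K) ∈ Submodule.span ℤ {x} * S.toSubmodule :=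
      hI'.ge (Submodule.one_le.mp S.one_le_toSubmodule)
    obtain ⟨s, hs, hxs⟩ := Submodule.mem_span_singleton_mul.mp h1
    refine ⟨x, ?_, s, hs, hxs, hIx⟩
    have h2 : x * 1 ∈ Submodule.span ℤ {x} * S.toSubmodule :=
      Submodule.mul_mem_mul (Submodule.mem_span_singleton_self _)
        (Submodule.one_le.mp S.one_le_toSubmodule)
    rw [hI', mul_one] at h2
    exact h2
  · rintro ⟨x, hx, s, hs, hxs, rfl⟩
    have hRR := R.toSubmodule_mul_self
    have hle : ∀ y : K, R.toSubmodule * (Submodule.span ℤ {y} * R.toSubmodule) ≤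
        Submodule.span ℤ {y} * R.toSubmodule := fun y => by rw [mul_left_comm, hRR]
    have hmul : Submodule.span ℤ {x} * R.toSubmodule * (Submodule.span ℤ {s} * R.toSubmodule) =
        R.toSubmodule := by
      rw [mul_mul_mul_comm, hRR, Submodule.span_mul_span, Set.singleton_mul_singleton, hxs,
        ← Submodule.one_eq_span, one_mul]
    refine ⟨⟨R.unitOfMulEq _ _ (hle x) (hle s) hmul, ?_, ?_⟩, rfl⟩
    · exact R.mem_principalUnits.mpr ⟨x, left_ne_zero_of_mul_eq_one hxs, rfl⟩
    · refine (hker _).mpr ?_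
      rw [Subalgebra.restrictScalars_unitOfMulEq, mul_left_comm, hSR]
      refine le_antisymm (Submodule.mul_le.mpr fun a ha b hb => ?_) fun z hz => ?_
      · obtain ⟨n, rfl⟩ := Submodule.mem_span_singleton.mp ha
        exact S.mul_mem (S.zsmul_mem hx n) hb
      · rw [Submodule.mem_span_singleton_mul]
        exact ⟨s * z, S.mul_mem hs hz, by rw [← mul_assoc, hxs, one_mul]⟩

end UnitClasses

/-! ### Imaginary quadratic orders -/

section QuadOrder

/-- The generator `(d + √d) / 2` of the quadratic order of discriminant `d < 0`. -/
noncomputable def quadGen (d : ℤ) : ℂ := ((d : ℂ) + Complex.I * (Real.sqrt (-(d : ℝ)) : ℂ)) / 2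

lemma four_dvd_sq_sub {d : ℤ} (h : d % 4 = 0 ∨ d % 4 = 1) : (4 : ℤ) ∣ d ^ 2 - d := by
  have h1 : d ^ 2 - d = d * (d - 1) := by ring
  rw [h1]
  rcases h with h | h
  · exact Dvd.dvd.mul_right (by omega) _
  · exact Dvd.dvd.mul_left (by omega) _

lemma sq_mul_emod_four {d : ℤ} (n : ℤ) (h : d % 4 = 0 ∨ d % 4 = 1) :
    (n ^ 2 * d) % 4 = 0 ∨ (n ^ 2 * d) % 4 = 1 := by
  rcases Int.even_or_odd' n with ⟨k, rfl | rfl⟩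
  · left
    have : (2 * k) ^ 2 * d = 4 * (k ^ 2 * d) := by ring
    omega
  · have : (2 * k + 1) ^ 2 * d = 4 * ((k ^ 2 + k) * d) + d := by ring
    omega

lemma quadGen_im (d : ℤ) : (quadGen d).im = Real.sqrt (-(d : ℝ)) / 2 := by
  simp [quadGen]

lemma quadGen_re (d : ℤ) : (quadGen d).re = d / 2 := by
  simp [quadGen]

lemma sq_sqrt_neg_intCast {d : ℤ} (hd : d < 0) : Real.sqrt (-(d : ℝ)) ^ 2 = -d := by
  have : (0 : ℝ) ≤ -d := by
    have : (d : ℝ) < 0 := by exact_mod_cast hd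
    linarith
  exact Real.sq_sqrt this

lemma quadGen_sq {d : ℤ} (hd : d < 0) (h : d % 4 = 0 ∨ d % 4 = 1) :
    quadGen d ^ 2 = d * quadGen d - ((d ^ 2 - d) / 4 : ℤ) := by
  obtain ⟨c, hc⟩ := four_dvd_sq_sub h
  rw [hc, Int.mul_ediv_cancel_left _ (by norm_num)]
  have h1 := congrArg (Complex.ofReal) (sq_sqrt_neg_intCast hd)
  have h2 := congrArg (Int.cast : ℤ → ℂ) hc
  push_cast at h1 h2
  rw [quadGen]
  linear_combination (1 / 4 : ℂ) * (Real.sqrt (-(d : ℝ)) : ℂ) ^ 2 * Complex.I_sq - 1 / 4 * h1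
    - 1 / 4 * h2

lemma quadOrder_isQuadraticOrder {d : ℤ} (hd : d < 0) (h : d % 4 = 0 ∨ d % 4 = 1) :
    IsQuadraticOrder (quadOrder d) (quadGen d) d ((d ^ 2 - d) / 4) where
  sq_eq := quadGen_sq hd h
  eq_zero := by
    intro x y hxy
    have hs : 0 < Real.sqrt (-(d : ℝ)) := by
      apply Real.sqrt_pos.mpr
      have : (d : ℝ) < 0 := by exact_mod_cast hd
      linarith
    have him := congrArg Complex.im hxy
    have hre := congrArg Complex.re hxy
    simp [quadGen_im] at him
    have hy : y = 0 := him.resolve_right hs.ne'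
    subst hy
    simp at hre
    exact ⟨hre, rfl⟩
  mem_iff := by
    intro z
    constructor
    · intro hz
      refine Algebra.adjoin_induction (p := fun z _ => ∃ x y : ℤ, z = x + y * quadGen d)
        ?_ ?_ ?_ ?_ hz
      · rintro z rfl
        exact ⟨0, 1, by simp [quadGen]⟩
      · intro r
        exact ⟨r, 0, by simp⟩
      · rintro _ _ _ _ ⟨x, y, rfl⟩ ⟨u, v, rfl⟩
        exact ⟨x + u, y + v, by push_cast; ring⟩
      · rintro _ _ _ _ ⟨x, y, rfl⟩ ⟨u, v, rfl⟩
        refine ⟨x * u - y * v * ((d ^ 2 - d) / 4), x * v + y * u + y * v * d, ?_⟩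
        rw [Int.cast_sub, Int.cast_mul (y * v)]
        push_cast
        linear_combination (y * v : ℂ) * quadGen_sq hd h
    · rintro ⟨x, y, rfl⟩
      have h1 : quadGen d ∈ quadOrder d := Algebra.subset_adjoin rfl
      exact (quadOrder d).add_mem (intCast_mem _ x) ((quadOrder d).mul_mem (intCast_mem _ y) h1)

lemma quadOrder_sq_mul {d : ℤ} (hd : d < 0) (h : d % 4 = 0 ∨ d % 4 = 1) {p : ℕ} (hp : p ≠ 0) :
    (quadOrder (p ^ 2 * d)).toSubmodule =
      1 + Submodule.span ℤ {(p : ℂ)} * (quadOrder d).toSubmodule := by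
  have hd' : (p : ℤ) ^ 2 * d < 0 := mul_neg_of_pos_of_neg (by positivity) hd
  have hsqrt : Real.sqrt (-(((p : ℤ) ^ 2 * d : ℤ) : ℝ)) = p * Real.sqrt (-(d : ℝ)) := by
    have : (-(((p : ℤ) ^ 2 * d : ℤ) : ℝ)) = (p : ℝ) ^ 2 * (-(d : ℝ)) := by push_cast; ring
    rw [this, Real.sqrt_mul (by positivity), Real.sqrt_sq (by positivity)]
  obtain ⟨e, he⟩ : ∃ e : ℤ, (p : ℤ) ^ 2 * d - p * d = 2 * e := by
    obtain ⟨k, hk⟩ := Int.even_mul_succ_self ((p : ℤ) - 1)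
    exact ⟨k * d, by linear_combination d * hk⟩
  have hgen : quadGen ((p : ℤ) ^ 2 * d) = e + p * quadGen d := by
    have h2 := congrArg (Int.cast : ℤ → ℂ) he
    rw [quadGen, hsqrt, quadGen]
    push_cast at h2 ⊢
    linear_combination (1 / 2 : ℂ) * h2
  ext z
  rw [(quadOrder_isQuadraticOrder hd h).mem_one_add_span, Subalgebra.mem_toSubmodule,
    (quadOrder_isQuadraticOrder hd' (sq_mul_emod_four p h)).mem_iff, hgen]
  constructor
  · rintro ⟨x, y, rfl⟩
    exact ⟨x + y * e, y, by push_cast; ring⟩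
  · rintro ⟨x, y, rfl⟩
    exact ⟨x - y * e, y, by push_cast; ring⟩

lemma four_mul_normSq_quadGen {d : ℤ} (hd : d < 0) (x y : ℤ) :
    4 * Complex.normSq (x + y * quadGen d) = ((2 * x + y * d) ^ 2 - d * y ^ 2 : ℤ) := by
  rw [Complex.normSq_apply]
  simp [quadGen_im, quadGen_re]
  linear_combination (y : ℝ) ^ 2 * sq_sqrt_neg_intCast hd

/-- The norm of an element of an imaginary quadratic order is a natural number. -/
lemma quadOrder_normSq_eq_natCast {d : ℤ} (hd : d < 0) (h : d % 4 = 0 ∨ d % 4 = 1) {z : ℂ}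
    (hz : z ∈ quadOrder d) : ∃ n : ℕ, Complex.normSq z = n := by
  obtain ⟨c, hc⟩ := four_dvd_sq_sub h
  obtain ⟨x, y, rfl⟩ := ((quadOrder_isQuadraticOrder hd h).mem_iff z).mp hz
  have h1 := four_mul_normSq_quadGen hd x y
  have h2 : (2 * x + y * d) ^ 2 - d * y ^ 2 = 4 * (x ^ 2 + x * y * d + y ^ 2 * c) := by
    linear_combination y ^ 2 * hc
  have h3 : 0 ≤ (x ^ 2 + x * y * d + y ^ 2 * c) := by
    nlinarith [sq_nonneg (2 * x + y * d), mul_nonneg (neg_nonneg.mpr hd.le) (sq_nonneg y)]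
  obtain ⟨n, hn⟩ := Int.eq_ofNat_of_zero_le h3
  rw [h2, hn] at h1
  exact ⟨n, by push_cast at h1; linarith⟩

/-- A unit of an imaginary quadratic order has norm one. -/
lemma quadOrder_unit_norm {d : ℤ} (hd : d < 0) (h : d % 4 = 0 ∨ d % 4 = 1) {z w : ℂ}
    (hz : z ∈ quadOrder d) (hw : w ∈ quadOrder d) (hzw : z * w = 1) :
    ∃ x y : ℤ, z = x + y * quadGen d ∧ (2 * x + y * d) ^ 2 - d * y ^ 2 = 4 := by
  have hS := quadOrder_isQuadraticOrder hd h
  obtain ⟨m, hm⟩ := quadOrder_normSq_eq_natCast hd h hz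
  obtain ⟨n, hn⟩ := quadOrder_normSq_eq_natCast hd h hw
  have h1 : m * n = 1 := by
    have := congrArg Complex.normSq hzw
    rw [Complex.normSq_mul, hm, hn, Complex.normSq_one] at this
    exact_mod_cast this
  obtain ⟨x, y, rfl⟩ := (hS.mem_iff z).mp hz
  refine ⟨x, y, rfl, ?_⟩
  have h2 := four_mul_normSq_quadGen hd x y
  rw [hm, Nat.eq_one_of_mul_eq_one_right h1] at h2
  have h3 : ((4 : ℤ) : ℝ) = ((2 * x + y * d) ^ 2 - d * y ^ 2 : ℤ) := by
    rw [← h2]; norm_num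
  exact_mod_cast h3.symm

end QuadOrder

/-! ### The class number formula for conductor `p` -/

section ClassNumberRelation

/-- The number of roots modulo `p` of the minimal polynomial of the generator of the quadratic
order of discriminant `d`; it is `1` plus the Kronecker symbol `(d / p)`. -/
noncomputable def quadRootCount (d : ℤ) (p : ℕ) : ℕ :=
  {a : ZMod p | a ^ 2 - (d : ZMod p) * a + (((d ^ 2 - d) / 4 : ℤ) : ZMod p) = 0}.ncard

/-- Half the number of units of the quadratic order of discriminant `d`. -/
def unitWeight (d : ℤ) : ℕ := if d = -3 then 3 else if d = -4 then 2 else 1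

lemma weightedClassNumber_eq {d : ℤ} (hd : d < 0) (h : d % 4 = 0 ∨ d % 4 = 1) :
    weightedClassNumber d = (orderClassNumber d : ℝ) / unitWeight d := by
  rw [weightedClassNumber, unitWeight]
  split_ifs <;> simp_all

lemma weightedClassNumber_eq_zero {d : ℤ} (h : ¬ (d < 0 ∧ (d % 4 = 0 ∨ d % 4 = 1))) :
    weightedClassNumber d = 0 := by
  rw [weightedClassNumber, if_neg, if_neg, if_neg h]
  · rintro rfl
    exact h (by norm_num)
  · rintro rfl
    exact h (by norm_num)

lemma ncard_unit_classes {d : ℤ} (hd : d < 0) (h : d % 4 = 0 ∨ d % 4 = 1) {p : ℕ}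
    (hp : p.Prime) {R : Subalgebra ℤ ℂ}
    (hR : R.toSubmodule = 1 + Submodule.span ℤ {(p : ℂ)} * (quadOrder d).toSubmodule) :
    {L : Submodule ℤ ℂ | ∃ x ∈ quadOrder d, ∃ s ∈ quadOrder d, x * s = 1 ∧
        L = Submodule.span ℤ {x} * R.toSubmodule}.ncard = unitWeight d := by
  have hS := quadOrder_isQuadraticOrder hd h
  have hp1 : ¬ (p : ℤ) ∣ 1 := (Nat.prime_iff_prime_int.mp hp).not_dvd_one
  -- an element of `R` has second coordinate divisible by `p`
  have hRmem : ∀ x y : ℤ, (x + y * quadGen d : ℂ) ∈ R → (p : ℤ) ∣ y := by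
    intro x y hxy
    obtain ⟨u, v, huv⟩ := (hS.mem_conductor hR).mp hxy
    exact ⟨v, (hS.ext_coord (x' := u) (y' := p * v) (by push_cast; exact huv)).2⟩
  by_cases h3 : d = -3
  · subst h3
    set ω : ℂ := 1 + quadGen (-3) with hω
    have hω2 : ω * ω = -2 - quadGen (-3) := by
      have := hS.sq_eq
      norm_num at this
      rw [hω]
      linear_combination this
    have hω3 : ω * (ω * ω) = 1 := by
      have := hS.sq_eq
      norm_num at this
      rw [hω2, hω]
      linear_combination -this
    have hωmem : ω ∈ quadOrder (-3) := by simpa using hS.mem 1 1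
    have hω2mem : ω * ω ∈ quadOrder (-3) := (quadOrder (-3)).mul_mem hωmem hωmem
    have hωR : ω ∉ R := fun hc => hp1 (hRmem 1 1 (by simpa using hc))
    have hω2R : ω * ω ∉ R := fun hc => by
      have := hRmem (-2) (-1) (by rw [hω2] at hc; push_cast; simpa [sub_eq_add_neg] using hc)
      exact hp1 (by simpa using this)
    have hset : {L : Submodule ℤ ℂ | ∃ x ∈ quadOrder (-3), ∃ s ∈ quadOrder (-3), x * s = 1 ∧
        L = Submodule.span ℤ {x} * R.toSubmodule} =
        {Submodule.span ℤ {1} * R.toSubmodule, Submodule.span ℤ {ω} * R.toSubmodule,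
          Submodule.span ℤ {ω * ω} * R.toSubmodule} := by
      ext L
      simp only [Set.mem_ofPred_eq, Set.mem_insert_iff, Set.mem_singleton_iff]
      constructor
      · rintro ⟨x, hx, s, hs, hxs, rfl⟩
        obtain ⟨u, v, rfl, huv⟩ := quadOrder_unit_norm hd h hx hs hxs
        have hv1 : v ≤ 1 := by nlinarith [sq_nonneg (2 * u + v * -3)]
        have hv2 : -1 ≤ v := by nlinarith [sq_nonneg (2 * u + v * -3)]
        obtain rfl | rfl | rfl : v = -1 ∨ v = 0 ∨ v = 1 := by omega
        · have : (u + 1) * (u + 2) = 0 := by linarith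
          rcases mul_eq_zero.mp this with h1 | h1
          · obtain rfl : u = -1 := by omega
            right; left
            rw [← Submodule.span_singleton_neg_eq]
            congr 3
            rw [hω]; push_cast; ring
          · obtain rfl : u = -2 := by omega
            right; right
            congr 3
            rw [hω2]; push_cast; ring
        · have : (u + 1) * (u - 1) = 0 := by linarith
          left
          rcases mul_eq_zero.mp this with h1 | h1
          · obtain rfl : u = -1 := by omega
            rw [← Submodule.span_singleton_neg_eq]
            congr 3
            push_cast; ring
          · obtain rfl : u = 1 := by omega
            congr 3
            push_cast; ring
        · have : (u - 1) * (u - 2) = 0 := by linarith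
          rcases mul_eq_zero.mp this with h1 | h1
          · obtain rfl : u = 1 := by omega
            right; left
            congr 3
            rw [hω]; push_cast; ring
          · obtain rfl : u = 2 := by omega
            right; right
            rw [← Submodule.span_singleton_neg_eq]
            congr 3
            rw [hω2]; push_cast; ring
      · rintro (rfl | rfl | rfl)
        · exact ⟨1, (quadOrder (-3)).one_mem, 1, (quadOrder (-3)).one_mem, one_mul 1, rfl⟩
        · exact ⟨ω, hωmem, ω * ω, hω2mem, hω3, rfl⟩
        · exact ⟨ω * ω, hω2mem, ω, hωmem, by rw [mul_comm, hω3], rfl⟩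
    have hω0 : ω ≠ 0 := left_ne_zero_of_mul_eq_one hω3
    rw [hset, Set.ncard_insert_of_notMem, Set.ncard_insert_of_notMem, Set.ncard_singleton]
    · rfl
    · rw [Set.mem_singleton_iff]
      intro hc
      obtain ⟨r, hr, hr'⟩ := Subalgebra.exists_mul_of_span_mul_eq hc
      exact hωR (mul_left_cancel₀ hω0 hr' ▸ hr)
    · rw [Set.mem_insert_iff, Set.mem_singleton_iff]
      rintro (hc | hc)
      · obtain ⟨r, hr, hr'⟩ := Subalgebra.exists_mul_of_span_mul_eq hc
        rw [one_mul] at hr'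
        exact hωR (hr' ▸ hr)
      · obtain ⟨r, hr, hr'⟩ := Subalgebra.exists_mul_of_span_mul_eq hc
        rw [one_mul] at hr'
        exact hω2R (hr' ▸ hr)
  by_cases h4 : d = -4
  · subst h4
    set i : ℂ := 2 + quadGen (-4) with hi
    have hi2 : i * i = -1 := by
      have := hS.sq_eq
      norm_num at this
      rw [hi]
      linear_combination this
    have himem : i ∈ quadOrder (-4) := by simpa using hS.mem 2 1
    have hiR : i ∉ R := fun hc => hp1 (hRmem 2 1 (by simpa using hc))
    have hset : {L : Submodule ℤ ℂ | ∃ x ∈ quadOrder (-4), ∃ s ∈ quadOrder (-4), x * s = 1 ∧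
        L = Submodule.span ℤ {x} * R.toSubmodule} =
        {Submodule.span ℤ {1} * R.toSubmodule, Submodule.span ℤ {i} * R.toSubmodule} := by
      ext L
      simp only [Set.mem_ofPred_eq, Set.mem_insert_iff, Set.mem_singleton_iff]
      constructor
      · rintro ⟨x, hx, s, hs, hxs, rfl⟩
        obtain ⟨u, v, rfl, huv⟩ := quadOrder_unit_norm hd h hx hs hxs
        have hv1 : v ≤ 1 := by nlinarith [sq_nonneg (2 * u + v * -4)]
        have hv2 : -1 ≤ v := by nlinarith [sq_nonneg (2 * u + v * -4)]
        obtain rfl | rfl | rfl : v = -1 ∨ v = 0 ∨ v = 1 := by omega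
        · have : (u + 2) ^ 2 = 0 := by linarith
          obtain rfl : u = -2 := by have := pow_eq_zero_iff (two_ne_zero) |>.mp this; omega
          right
          rw [← Submodule.span_singleton_neg_eq]
          congr 3
          rw [hi]; push_cast; ring
        · have : (u + 1) * (u - 1) = 0 := by linarith
          left
          rcases mul_eq_zero.mp this with h1 | h1
          · obtain rfl : u = -1 := by omega
            rw [← Submodule.span_singleton_neg_eq]
            congr 3
            push_cast; ring
          · obtain rfl : u = 1 := by omega
            congr 3
            push_cast; ring
        · have : (u - 2) ^ 2 = 0 := by linarith
          obtain rfl : u = 2 := by have := pow_eq_zero_iff (two_ne_zero) |>.mp this; omega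
          right
          congr 3
          rw [hi]; push_cast; ring
      · rintro (rfl | rfl)
        · exact ⟨1, (quadOrder (-4)).one_mem, 1, (quadOrder (-4)).one_mem, one_mul 1, rfl⟩
        · exact ⟨i, himem, -i, (quadOrder (-4)).neg_mem himem, by rw [mul_neg, hi2, neg_neg], rfl⟩
    rw [hset, Set.ncard_insert_of_notMem, Set.ncard_singleton]
    · rfl
    · rw [Set.mem_singleton_iff]
      intro hc
      obtain ⟨r, hr, hr'⟩ := Subalgebra.exists_mul_of_span_mul_eq hc
      rw [one_mul] at hr'
      exact hiR (hr' ▸ hr)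
  · have hd5 : d ≤ -5 := by omega
    have hset : {L : Submodule ℤ ℂ | ∃ x ∈ quadOrder d, ∃ s ∈ quadOrder d, x * s = 1 ∧
        L = Submodule.span ℤ {x} * R.toSubmodule} = {Submodule.span ℤ {1} * R.toSubmodule} := by
      ext L
      simp only [Set.mem_ofPred_eq, Set.mem_singleton_iff]
      constructor
      · rintro ⟨x, hx, s, hs, hxs, rfl⟩
        obtain ⟨u, v, rfl, huv⟩ := quadOrder_unit_norm hd h hx hs hxs
        have hv : v = 0 := by
          by_contra hv
          have : 1 ≤ v ^ 2 := by
            have : 0 < v ^ 2 := by positivity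
            omega
          nlinarith [sq_nonneg (2 * u + v * d)]
        subst hv
        have : (u + 1) * (u - 1) = 0 := by linarith
        rcases mul_eq_zero.mp this with h1 | h1
        · obtain rfl : u = -1 := by omega
          rw [← Submodule.span_singleton_neg_eq]
          congr 3
          push_cast; ring
        · obtain rfl : u = 1 := by omega
          congr 3
          push_cast; ring
      · rintro rfl
        exact ⟨1, (quadOrder d).one_mem, 1, (quadOrder d).one_mem, one_mul 1, rfl⟩
    rw [hset, Set.ncard_singleton, unitWeight, if_neg h3, if_neg h4]

/-- The class number formula `h_w(p² d) = (p - (d / p)) h_w(d)` for orders of conductor `p`, with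
the Kronecker symbol as the number of roots minus one. -/
theorem weightedClassNumber_sq_mul {d : ℤ} (hd : d < 0) (h : d % 4 = 0 ∨ d % 4 = 1) {p : ℕ}
    (hp : p.Prime) :
    weightedClassNumber ((p : ℤ) ^ 2 * d) =
      ((p : ℝ) + 1 - quadRootCount d p) * weightedClassNumber d := by
  have : Fact p.Prime := ⟨hp⟩
  have hS := quadOrder_isQuadraticOrder hd h
  have hR := quadOrder_sq_mul hd h hp.ne_zero
  have hle := IsQuadraticOrder.le_of_conductor hR
  have := hS.finite_quotient hp.ne_zero
  have h1 := Subalgebra.card_classGroup_mul hle (Subalgebra.extendUnits_surjective hle p hR)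
  rw [Subalgebra.card_principalUnits_inf_ker, ncard_unit_classes hd h hp hR] at h1
  have h2 := hS.card_ker hle hR
  have h3 : (orderClassNumber ((p : ℤ) ^ 2 * d) : ℝ) * unitWeight d =
      orderClassNumber d * ((p : ℝ) + 1 - quadRootCount d p) := by
    have h4 : ((p : ℝ) + 1 - quadRootCount d p) =
        Nat.card (Subalgebra.extendUnits hle).ker := by
      rw [quadRootCount, sub_eq_iff_eq_add]
      exact_mod_cast h2.symm
    rw [h4]
    exact_mod_cast h1
  have hp2 : 4 ≤ (p : ℤ) ^ 2 := by
    have : (2 : ℤ) ≤ p := by exact_mod_cast hp.two_le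
    nlinarith
  have h5 : weightedClassNumber ((p : ℤ) ^ 2 * d) = orderClassNumber ((p : ℤ) ^ 2 * d) := by
    have hlt : (p : ℤ) ^ 2 * d < -4 ∨ d = -1 := by
      by_cases hd1 : d = -1
      · exact Or.inr hd1
      · left
        have : d ≤ -2 := by omega
        nlinarith
    have hlt : (p : ℤ) ^ 2 * d < -4 := hlt.resolve_right (by omega)
    rw [weightedClassNumber_eq (by omega) (sq_mul_emod_four p h), unitWeight, if_neg (by omega),
      if_neg (by omega)]
    simp
  have hw : (unitWeight d : ℝ) ≠ 0 := by
    rw [unitWeight]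
    split_ifs <;> norm_num
  rw [h5, weightedClassNumber_eq hd h]
  field_simp
  linear_combination h3

end ClassNumberRelation

/-! ### The discriminants `-3` and `-4` -/

section ClassNumberOne

/-- The quadratic orders of discriminant `-3` and `-4` are Euclidean for the norm. -/
lemma isPrincipalIdealRing_quadOrder {d : ℤ} (hd : d = -3 ∨ d = -4) :
    IsPrincipalIdealRing (quadOrder d) := by
  have hd0 : d < 0 := by omega
  have h : d % 4 = 0 ∨ d % 4 = 1 := by omega
  have hS := quadOrder_isQuadraticOrder hd0 h
  -- rounding both coordinates leaves a remainder of norm less than one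
  have hround : ∀ ζ : ℂ, ∃ w ∈ quadOrder d, Complex.normSq (ζ - w) < 1 := by
    intro ζ
    set s := Real.sqrt (-(d : ℝ)) with hs
    have hs2 : s ^ 2 = -d := sq_sqrt_neg_intCast hd0
    have hs4 : s ^ 2 ≤ 4 := by rw [hs2]; rcases hd with rfl | rfl <;> norm_num
    have hs0 : 0 < s := Real.sqrt_pos.mpr (by rcases hd with rfl | rfl <;> norm_num)
    set y : ℤ := round (ζ.im / (s / 2)) with hy
    set x : ℤ := round (ζ.re - y * (d / 2)) with hx
    refine ⟨x + y * quadGen d, hS.mem x y, ?_⟩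
    have h1 : |ζ.im / (s / 2) - y| ≤ 1 / 2 := abs_sub_round _
    have h2 : |ζ.re - y * (d / 2) - x| ≤ 1 / 2 := abs_sub_round _
    rw [Complex.normSq_apply]
    simp only [Complex.sub_re, Complex.sub_im, Complex.add_re, Complex.add_im, Complex.mul_re,
      Complex.mul_im, Complex.intCast_re, Complex.intCast_im, quadGen_im, quadGen_re]
    rw [← hs]
    have h3 : ζ.im = (ζ.im / (s / 2)) * (s / 2) := by field_simp
    set e := ζ.im / (s / 2) - y with he
    set e' := ζ.re - y * (d / 2) - x with he'
    have h4 : e ^ 2 ≤ 1 / 4 := by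
      have := sq_le_sq' (abs_le.mp h1).1 (abs_le.mp h1).2
      linarith
    have h5 : e' ^ 2 ≤ 1 / 4 := by
      have := sq_le_sq' (abs_le.mp h2).1 (abs_le.mp h2).2
      linarith
    have h6 : ζ.re - (x + (y * (d / 2) - 0 * (s / 2))) = e' := by rw [he']; ring
    have h7 : ζ.im - (0 + (y * (s / 2) + 0 * (d / 2))) = e * (s / 2) := by
      rw [he]; linear_combination h3
    rw [h6, h7]
    nlinarith [mul_le_mul h4 hs4 (sq_nonneg s) (by norm_num)]
  refine ⟨fun I => ?_⟩
  by_cases hI : I = ⊥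
  · exact hI ▸ bot_isPrincipal
  obtain ⟨z₀, hz₀, hz₀0⟩ := Submodule.exists_mem_ne_zero_of_ne_bot hI
  have hex : ∃ n : ℕ, ∃ z ∈ I, z ≠ 0 ∧ Complex.normSq (z : ℂ) = n := by
    obtain ⟨n, hn⟩ := quadOrder_normSq_eq_natCast hd0 h z₀.2
    exact ⟨n, z₀, hz₀, hz₀0, hn⟩
  classical
  obtain ⟨z, hz, hz0, hzn⟩ := Nat.find_spec hex
  refine ⟨z, le_antisymm (fun w hw => ?_) ((Ideal.span_singleton_le_iff_mem I).mpr hz)⟩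
  have hz0' : (z : ℂ) ≠ 0 := fun hc => hz0 (Subtype.ext hc)
  obtain ⟨q, hq, hlt⟩ := hround (w / z)
  have hr : w - ⟨q, hq⟩ * z ∈ I := I.sub_mem hw (I.mul_mem_left _ hz)
  have hrn : Complex.normSq ((w - ⟨q, hq⟩ * z : quadOrder d) : ℂ) < Complex.normSq (z : ℂ) := by
    have h1 : ((w - ⟨q, hq⟩ * z : quadOrder d) : ℂ) = (w / z - q) * z := by
      push_cast
      field_simp
    rw [h1, Complex.normSq_mul]
    have := Complex.normSq_pos.mpr hz0'
    nlinarith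
  obtain ⟨m, hm⟩ := quadOrder_normSq_eq_natCast hd0 h (w - ⟨q, hq⟩ * z : quadOrder d).2
  have hr0 : w - ⟨q, hq⟩ * z = 0 := by
    by_contra hne
    have := Nat.find_min' hex ⟨_, hr, hne, hm⟩
    rw [hm, hzn] at hrn
    exact absurd hrn (not_lt.mpr (by exact_mod_cast this))
  exact Ideal.mem_span_singleton'.mpr ⟨⟨q, hq⟩, (sub_eq_zero.mp hr0).symm⟩

lemma orderClassNumber_eq_one {d : ℤ} (hd : d = -3 ∨ d = -4) : orderClassNumber d = 1 := by
  have := isPrincipalIdealRing_quadOrder hd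
  rw [orderClassNumber, Nat.card_eq_fintype_card, card_classGroup_eq_one]

lemma weightedClassNumber_neg_three : weightedClassNumber (-3) = 1 / 3 := by
  rw [weightedClassNumber, if_pos rfl, orderClassNumber_eq_one (Or.inl rfl), Nat.cast_one]

lemma weightedClassNumber_neg_four : weightedClassNumber (-4) = 1 / 2 := by
  rw [weightedClassNumber, if_neg (by norm_num), if_pos rfl, orderClassNumber_eq_one (Or.inr rfl),
    Nat.cast_one]

end ClassNumberOne

/-! ### Roots modulo `p` and the Kronecker symbol -/

section Kronecker

lemma quadRootCount_eq {d : ℤ} (h : d % 4 = 0 ∨ d % 4 = 1) {p : ℕ} (hp : p.Prime) :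
    (quadRootCount d p : ℤ) = 1 + kroneckerPrime d p := by
  rw [quadRootCount, kroneckerPrime]
  split_ifs with h2 hd hd
  · subst h2
    obtain ⟨k, rfl⟩ : ∃ k, d = 4 * k := ⟨d / 4, by omega⟩
    have h4 : ((4 * k) ^ 2 - 4 * k) / 4 = 4 * k ^ 2 - k := by
      rw [show (4 * k) ^ 2 - 4 * k = 4 * (4 * k ^ 2 - k) by ring]
      exact Int.mul_ediv_cancel_left _ (by norm_num)
    have hset : {a : ZMod 2 | a ^ 2 - ((4 * k : ℤ) : ZMod 2) * a +
        ((((4 * k) ^ 2 - 4 * k) / 4 : ℤ) : ZMod 2) = 0} = {(k : ZMod 2)} := by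
      ext a
      rw [h4]
      push_cast
      generalize (k : ZMod 2) = k'
      revert a k'
      simp only [Set.mem_ofPred_eq, Set.mem_singleton_iff]
      decide
    rw [hset, Set.ncard_singleton]
    rfl
  · subst h2
    obtain ⟨k, rfl⟩ : ∃ k, d = 8 * k + 1 := ⟨d / 8, by omega⟩
    have h4 : ((8 * k + 1) ^ 2 - (8 * k + 1)) / 4 = 2 * k * (8 * k + 1) := by
      rw [show (8 * k + 1) ^ 2 - (8 * k + 1) = 4 * (2 * k * (8 * k + 1)) by ring]
      exact Int.mul_ediv_cancel_left _ (by norm_num)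
    have hset : {a : ZMod 2 | a ^ 2 - ((8 * k + 1 : ℤ) : ZMod 2) * a +
        ((((8 * k + 1) ^ 2 - (8 * k + 1)) / 4 : ℤ) : ZMod 2) = 0} = Set.univ := by
      ext a
      rw [h4]
      push_cast
      generalize (k : ZMod 2) = k'
      revert a k'
      simp only [Set.mem_ofPred_eq, Set.mem_univ, iff_true]
      decide
    rw [hset, Set.ncard_univ, Nat.card_zmod]
    rfl
  · subst h2
    obtain ⟨k, rfl⟩ : ∃ k, d = 8 * k + 5 := ⟨d / 8, by omega⟩
    have h4 : ((8 * k + 5) ^ 2 - (8 * k + 5)) / 4 = (2 * k + 1) * (8 * k + 5) := by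
      rw [show (8 * k + 5) ^ 2 - (8 * k + 5) = 4 * ((2 * k + 1) * (8 * k + 5)) by ring]
      exact Int.mul_ediv_cancel_left _ (by norm_num)
    have hset : {a : ZMod 2 | a ^ 2 - ((8 * k + 5 : ℤ) : ZMod 2) * a +
        ((((8 * k + 5) ^ 2 - (8 * k + 5)) / 4 : ℤ) : ZMod 2) = 0} = ∅ := by
      ext a
      rw [h4]
      push_cast
      generalize (k : ZMod 2) = k'
      revert a k'
      simp only [Set.mem_ofPred_eq, Set.mem_empty_iff_false, iff_false]
      decide
    rw [hset, Set.ncard_empty]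
    rfl
  · -- for odd `p` complete the square
    have : Fact p.Prime := ⟨hp⟩
    have h2' : (2 : ZMod p) ≠ 0 := by
      intro hc
      have := (ZMod.natCast_eq_zero_iff 2 p).mp (by exact_mod_cast hc)
      exact h2 ((Nat.prime_dvd_prime_iff_eq hp Nat.prime_two).mp this)
    obtain ⟨c, hc⟩ := four_dvd_sq_sub h
    rw [hc, Int.mul_ediv_cancel_left _ (by norm_num)]
    have hc' : (d : ZMod p) ^ 2 - d = 4 * c := by exact_mod_cast congrArg (Int.cast : ℤ → ZMod p) hc
    rw [← jacobiSym.legendreSym.to_jacobiSym, add_comm, ← legendreSym.card_sqrts p h2 d,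
      ← Set.ncard_eq_toFinset_card']
    have hset : {x : ZMod p | x ^ 2 = d} = (fun a => 2 * a - (d : ZMod p)) ''
        {a : ZMod p | a ^ 2 - (d : ZMod p) * a + (c : ZMod p) = 0} := by
      ext x
      constructor
      · intro hx
        change x ^ 2 = d at hx
        refine ⟨(x + d) / 2, ?_, by field_simp; ring⟩
        change ((x + d) / 2) ^ 2 - (d : ZMod p) * ((x + d) / 2) + (c : ZMod p) = 0
        have h4 : (2 : ZMod p) ^ 2 ≠ 0 := pow_ne_zero 2 h2'
        field_simp
        linear_combination hx - hc'
      · rintro ⟨a, ha, rfl⟩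
        change a ^ 2 - (d : ZMod p) * a + (c : ZMod p) = 0 at ha
        change (2 * a - (d : ZMod p)) ^ 2 = d
        linear_combination 4 * ha + hc'
    rw [hset, Set.ncard_image_of_injective]
    intro a b hab
    exact mul_left_cancel₀ h2' (sub_left_injective hab)

/-- The class number formula for orders of conductor `p`. -/
lemma weightedClassNumber_prime_sq_mul {d : ℤ} (hd : d < 0) (h : d % 4 = 0 ∨ d % 4 = 1) {p : ℕ}
    (hp : p.Prime) :
    weightedClassNumber ((p : ℤ) ^ 2 * d) =
      ((p : ℝ) - kroneckerPrime d p) * weightedClassNumber d := by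
  rw [weightedClassNumber_sq_mul hd h hp]
  have := congrArg (Int.cast : ℤ → ℝ) (quadRootCount_eq h hp)
  push_cast at this
  rw [this]
  ring

lemma kroneckerPrime_eq_zero {d : ℤ} {p : ℕ} (hp : p.Prime) (h : (p : ℤ) ∣ d) :
    kroneckerPrime d p = 0 := by
  have : Fact p.Prime := ⟨hp⟩
  rw [kroneckerPrime]
  split_ifs with h1 h2 h3
  · rfl
  · subst h1; exact absurd h h2
  · subst h1; exact absurd h h2
  · rw [← jacobiSym.legendreSym.to_jacobiSym, legendreSym.eq_zero_iff,
      ZMod.intCast_zmod_eq_zero_iff_dvd]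
    exact h

lemma kroneckerPrime_eq_one {d g u w : ℤ} {p : ℕ} (hp : p.Prime) (hu : ¬ (p : ℤ) ∣ u)
    (h : g ^ 2 * d = u ^ 2 - 4 * (p * w)) : kroneckerPrime d p = 1 := by
  have : Fact p.Prime := ⟨hp⟩
  have hpp : Prime (p : ℤ) := Nat.prime_iff_prime_int.mp hp
  have hg : ¬ (p : ℤ) ∣ g := by
    intro hg
    refine hu (hpp.dvd_of_dvd_pow (n := 2) ?_)
    rw [show u ^ 2 = g * (g * d) + p * (4 * w) by linear_combination -h]
    exact dvd_add (hg.mul_right _) (dvd_mul_right _ _)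
  rw [kroneckerPrime]
  split_ifs with h1 h2 h3
  · subst h1
    push_cast at *
    refine absurd (hpp.dvd_of_dvd_pow (n := 2) ?_) hu
    rw [show u ^ 2 = g ^ 2 * d + 2 * (4 * w) by linear_combination -h]
    exact dvd_add (h2.mul_left _) (dvd_mul_right _ _)
  · rfl
  · subst h1
    push_cast at *
    have hsq : ∀ x : ℤ, ¬ (2 : ℤ) ∣ x → x ^ 2 % 8 = 1 := fun x hx => by
      have := Int.eight_dvd_sq_sub_one_of_odd (Int.not_even_iff_odd.mp fun he => hx he.two_dvd)
      omega
    have hg8 := hsq g hg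
    have hu8 := hsq u hu
    exfalso
    have h5 : (g ^ 2 * d) % 8 = d % 8 := by
      rw [Int.mul_emod, hg8, one_mul, Int.emod_emod_of_dvd _ (dvd_refl 8)]
    omega
  · rw [← jacobiSym.legendreSym.to_jacobiSym]
    have hg' : (g : ZMod p) ≠ 0 := fun hc => hg ((ZMod.intCast_zmod_eq_zero_iff_dvd g p).mp hc)
    have hu' : (u : ZMod p) ≠ 0 := fun hc => hu ((ZMod.intCast_zmod_eq_zero_iff_dvd u p).mp hc)
    have h' : (g : ZMod p) ^ 2 * d = u ^ 2 := by
      have := congrArg (Int.cast : ℤ → ZMod p) h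
      push_cast at this
      rwa [CharP.cast_eq_zero, zero_mul, mul_zero, sub_zero] at this
    have hd : (d : ZMod p) = (u / g : ZMod p) ^ 2 := by
      field_simp
      linear_combination h'
    rw [legendreSym.eq_one_iff]
    · exact ⟨u / g, by rw [hd, sq]⟩
    · rw [hd]
      exact pow_ne_zero 2 (div_ne_zero hu' hg')

end Kronecker

/-! ### Hurwitz class numbers of `p² E` -/

section Hurwitz

/-- The positive integers whose square divides `Δ`, for `Δ ≠ 0`. -/
def squareDivisors (Δ : ℤ) : Finset ℕ :=
  Δ.natAbs.divisors.filter (fun f : ℕ => (f : ℤ) ^ 2 ∣ Δ)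

lemma mem_squareDivisors {Δ : ℤ} (hΔ : Δ ≠ 0) {f : ℕ} :
    f ∈ squareDivisors Δ ↔ (f : ℤ) ^ 2 ∣ Δ := by
  rw [squareDivisors, Finset.mem_filter, Nat.mem_divisors, and_iff_right_iff_imp]
  intro h
  refine ⟨?_, Int.natAbs_ne_zero.mpr hΔ⟩
  exact Int.natCast_dvd.mp ((dvd_pow_self _ two_ne_zero).trans h)

lemma hurwitzClassNumber_eq_sum (Δ : ℤ) :
    hurwitzClassNumber Δ = ∑ f ∈ squareDivisors Δ, weightedClassNumber (Δ / (f : ℤ) ^ 2) := rfl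

lemma pos_of_sq_dvd {Δ : ℤ} (hΔ : Δ ≠ 0) {f : ℕ} (h : (f : ℤ) ^ 2 ∣ Δ) : 0 < f := by
  rcases Nat.eq_zero_or_pos f with rfl | h0
  · exact absurd (by simpa using h) hΔ
  · exact h0

lemma odd_sq_mul_emod_four {n : ℤ} (hn : ¬ (2 : ℤ) ∣ n) (e : ℤ) : (n ^ 2 * e) % 4 = e % 4 := by
  obtain ⟨k, rfl⟩ : ∃ k, n = 2 * k + 1 := ⟨n / 2, by omega⟩
  have : (2 * k + 1) ^ 2 * e = 4 * ((k ^ 2 + k) * e) + e := by ring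
  omega

lemma sq_dvd_prime_sq_mul_iff {p n : ℕ} (hp : p.Prime) (hn : ¬ p ∣ n) {Δ : ℤ} :
    (n : ℤ) ^ 2 ∣ (p : ℤ) ^ 2 * Δ ↔ (n : ℤ) ^ 2 ∣ Δ := by
  refine ⟨fun h => ?_, fun h => h.mul_left _⟩
  refine IsCoprime.dvd_of_dvd_mul_left (IsCoprime.pow ?_) h
  exact (Nat.isCoprime_iff_coprime.mpr ((Nat.Prime.coprime_iff_not_dvd hp).mpr hn)).symm

lemma hurwitzClassNumber_prime_sq_mul_eq_add {p : ℕ} (hp : p.Prime) {E : ℤ} (hE : E ≠ 0) :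
    hurwitzClassNumber ((p : ℤ) ^ 2 * E) = hurwitzClassNumber E +
      ∑ f ∈ (squareDivisors ((p : ℤ) ^ 2 * E)).filter (fun f => ¬ p ∣ f),
        weightedClassNumber ((p : ℤ) ^ 2 * E / (f : ℤ) ^ 2) := by
  have hp0 : (p : ℤ) ^ 2 ≠ 0 := pow_ne_zero 2 (by exact_mod_cast hp.ne_zero)
  have hpE : (p : ℤ) ^ 2 * E ≠ 0 := mul_ne_zero hp0 hE
  rw [hurwitzClassNumber_eq_sum ((p : ℤ) ^ 2 * E),
    ← Finset.sum_filter_add_sum_filter_not _ (fun f => p ∣ f), hurwitzClassNumber_eq_sum E]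
  congr 1
  symm
  refine Finset.sum_nbij (fun g => p * g) ?_ ?_ ?_ ?_
  · intro g hg
    rw [mem_squareDivisors hE] at hg
    rw [Finset.mem_filter, mem_squareDivisors hpE]
    refine ⟨?_, dvd_mul_right p g⟩
    push_cast
    rw [mul_pow]
    exact mul_dvd_mul_left _ hg
  · intro a _ b _ hab
    exact Nat.eq_of_mul_eq_mul_left hp.pos hab
  · intro f hf
    rw [Finset.mem_coe, Finset.mem_filter, mem_squareDivisors hpE] at hf
    obtain ⟨hf, g, rfl⟩ := hf
    refine ⟨g, ?_, rfl⟩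
    rw [Finset.mem_coe, mem_squareDivisors hE]
    push_cast at hf
    rw [mul_pow] at hf
    exact Int.dvd_of_mul_dvd_mul_left hp0 hf
  · intro g _
    push_cast
    rw [mul_pow, Int.mul_ediv_mul_of_pos _ _ (by positivity)]

/-- The class number formula for any `e` in the square class of `E`: if `e` is not a discriminant,
then neither is `p² e`, where for `p = 2` one needs that `E` is a discriminant. -/
lemma weightedClassNumber_prime_sq_mul_of_sq_mul {p : ℕ} (hp : p.Prime) {E e f : ℤ} (hE : E < 0)
    (h : (E % 4 = 0 ∨ E % 4 = 1) ∨ p ≠ 2) (hf : ¬ (p : ℤ) ∣ f) (hfe : f ^ 2 * e = E) :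
    weightedClassNumber ((p : ℤ) ^ 2 * e) =
      ((p : ℝ) - kroneckerPrime e p) * weightedClassNumber e := by
  have he : e < 0 := by
    by_contra hcon
    have : 0 ≤ f ^ 2 * e := mul_nonneg (sq_nonneg f) (not_lt.mp hcon)
    omega
  by_cases hd : e % 4 = 0 ∨ e % 4 = 1
  · exact weightedClassNumber_prime_sq_mul he hd hp
  · rw [weightedClassNumber_eq_zero (fun hc => hd hc.2), mul_zero]
    refine weightedClassNumber_eq_zero (fun hc => hd ?_)
    rcases eq_or_ne p 2 with rfl | hp2
    · rw [← odd_sq_mul_emod_four hf, hfe]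
      exact h.resolve_right (fun h => h rfl)
    · rw [← odd_sq_mul_emod_four (n := (p : ℤ))]
      · exact hc.2
      · intro hc2
        exact hp2 ((Nat.prime_dvd_prime_iff_eq Nat.prime_two hp).mp (by exact_mod_cast hc2)).symm

lemma hurwitzClassNumber_prime_sq_mul {p : ℕ} (hp : p.Prime) {E : ℤ} (hE : E < 0)
    (h : (E % 4 = 0 ∨ E % 4 = 1) ∨ p ≠ 2) :
    hurwitzClassNumber ((p : ℤ) ^ 2 * E) = hurwitzClassNumber E +
      ∑ f ∈ (squareDivisors E).filter (fun f => ¬ p ∣ f),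
        ((p : ℝ) - kroneckerPrime (E / (f : ℤ) ^ 2) p) *
          weightedClassNumber (E / (f : ℤ) ^ 2) := by
  have hp0 : (p : ℤ) ^ 2 ≠ 0 := pow_ne_zero 2 (by exact_mod_cast hp.ne_zero)
  have hpE : (p : ℤ) ^ 2 * E ≠ 0 := mul_ne_zero hp0 hE.ne
  rw [hurwitzClassNumber_prime_sq_mul_eq_add hp hE.ne]
  congr 1
  refine Finset.sum_congr ?_ ?_
  · ext f
    rw [Finset.mem_filter, Finset.mem_filter, mem_squareDivisors hpE, mem_squareDivisors hE.ne]
    exact and_congr_left fun hf => sq_dvd_prime_sq_mul_iff hp hf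
  · intro f hf
    rw [Finset.mem_filter, mem_squareDivisors hE.ne] at hf
    rw [Int.mul_ediv_assoc _ hf.1]
    exact weightedClassNumber_prime_sq_mul_of_sq_mul hp hE h
      (fun hc => hf.2 (by exact_mod_cast hc)) (Int.mul_ediv_cancel' hf.1)

/-- The quantity `H(p² E) - p H(E)` does not change when `E` is multiplied by `p²`. -/
lemma hurwitzClassNumber_sub_prime_sq_mul {p : ℕ} (hp : p.Prime) {E : ℤ} (hE : E < 0) :
    hurwitzClassNumber ((p : ℤ) ^ 2 * ((p : ℤ) ^ 2 * E))
        - p * hurwitzClassNumber ((p : ℤ) ^ 2 * E) =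
      hurwitzClassNumber ((p : ℤ) ^ 2 * E) - p * hurwitzClassNumber E := by
  have hp0 : 0 < (p : ℤ) ^ 2 := pow_pos (by exact_mod_cast hp.pos) 2
  have hpE : (p : ℤ) ^ 2 * E < 0 := mul_neg_of_pos_of_neg hp0 hE
  have hcond : (((p : ℤ) ^ 2 * E) % 4 = 0 ∨ ((p : ℤ) ^ 2 * E) % 4 = 1) ∨ p ≠ 2 := by
    rcases eq_or_ne p 2 with rfl | hp2
    · left; left
      push_cast
      omega
    · exact Or.inr hp2
  have h1 := hurwitzClassNumber_prime_sq_mul_eq_add hp hE.ne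
  rw [hurwitzClassNumber_prime_sq_mul hp hpE hcond]
  have h2 : ∑ f ∈ (squareDivisors ((p : ℤ) ^ 2 * E)).filter (fun f => ¬ p ∣ f),
        ((p : ℝ) - kroneckerPrime ((p : ℤ) ^ 2 * E / (f : ℤ) ^ 2) p) *
          weightedClassNumber ((p : ℤ) ^ 2 * E / (f : ℤ) ^ 2) =
      p * ∑ f ∈ (squareDivisors ((p : ℤ) ^ 2 * E)).filter (fun f => ¬ p ∣ f),
        weightedClassNumber ((p : ℤ) ^ 2 * E / (f : ℤ) ^ 2) := by
    rw [Finset.mul_sum]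
    refine Finset.sum_congr rfl fun f hf => ?_
    rw [Finset.mem_filter, mem_squareDivisors hpE.ne, sq_dvd_prime_sq_mul_iff hp] at hf
    · rw [kroneckerPrime_eq_zero hp]
      · simp
      · rw [Int.mul_ediv_assoc _ hf.1, sq, mul_assoc]
        exact dvd_mul_right _ _
    · exact hf.2
  rw [h2]
  linear_combination (-(p : ℝ)) * h1

lemma hurwitzClassNumber_sub_of_kronecker {p : ℕ} (hp : p.Prime) {E : ℤ} (hE : E < 0)
    (h : (E % 4 = 0 ∨ E % 4 = 1) ∨ p ≠ 2) {χ : ℤ}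
    (hχ : ∀ f e : ℤ, f ^ 2 * e = E → (e % 4 = 0 ∨ e % 4 = 1) →
      ¬ (p : ℤ) ∣ f ∧ kroneckerPrime e p = χ) :
    hurwitzClassNumber ((p : ℤ) ^ 2 * E) - p * hurwitzClassNumber E =
      (1 - (χ : ℝ)) * hurwitzClassNumber E := by
  rw [hurwitzClassNumber_prime_sq_mul hp hE h]
  have h1 : ∑ f ∈ (squareDivisors E).filter (fun f => ¬ p ∣ f),
        ((p : ℝ) - kroneckerPrime (E / (f : ℤ) ^ 2) p) * weightedClassNumber (E / (f : ℤ) ^ 2) =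
      ((p : ℝ) - χ) * hurwitzClassNumber E := by
    rw [hurwitzClassNumber_eq_sum, Finset.mul_sum, Finset.sum_filter]
    refine Finset.sum_congr rfl fun f hf => ?_
    rw [mem_squareDivisors hE.ne] at hf
    by_cases hd : E / (f : ℤ) ^ 2 % 4 = 0 ∨ E / (f : ℤ) ^ 2 % 4 = 1
    · obtain ⟨hpf, hk⟩ := hχ f _ (Int.mul_ediv_cancel' hf) hd
      rw [hk, if_pos (fun hc => hpf (by exact_mod_cast hc))]
    · rw [weightedClassNumber_eq_zero (fun hc => hd hc.2), mul_zero, mul_zero, ite_self]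
  rw [h1]
  ring

lemma hurwitzQuot_prime_sq_mul {p n : ℕ} (hp : p.Prime) (hn : ¬ p ∣ n) (Δ : ℤ) :
    hurwitzQuot ((p : ℤ) ^ 2 * Δ) n =
      if (n : ℤ) ^ 2 ∣ Δ then hurwitzClassNumber ((p : ℤ) ^ 2 * (Δ / (n : ℤ) ^ 2)) else 0 := by
  rw [hurwitzQuot]
  by_cases h : (n : ℤ) ^ 2 ∣ Δ
  · rw [if_pos h, if_pos ((sq_dvd_prime_sq_mul_iff hp hn).mpr h), Int.mul_ediv_assoc _ h]
  · rw [if_neg h, if_neg (fun hc => h ((sq_dvd_prime_sq_mul_iff hp hn).mp hc))]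

lemma ediv_sq_neg {Δ : ℤ} (hΔ : Δ < 0) {n : ℕ} (h : (n : ℤ) ^ 2 ∣ Δ) : Δ / (n : ℤ) ^ 2 < 0 := by
  by_contra hcon
  have h1 := Int.mul_ediv_cancel' h
  have : 0 ≤ (n : ℤ) ^ 2 * (Δ / (n : ℤ) ^ 2) := mul_nonneg (sq_nonneg _) (not_lt.mp hcon)
  omega

lemma hurwitzQuot_sub_prime_sq_mul {p n : ℕ} (hp : p.Prime) (hn : ¬ p ∣ n) {Δ : ℤ} (hΔ : Δ < 0) :
    hurwitzQuot ((p : ℤ) ^ 2 * ((p : ℤ) ^ 2 * Δ)) n - p * hurwitzQuot ((p : ℤ) ^ 2 * Δ) n =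
      hurwitzQuot ((p : ℤ) ^ 2 * Δ) n - p * hurwitzQuot Δ n := by
  rw [hurwitzQuot_prime_sq_mul hp hn, hurwitzQuot_prime_sq_mul hp hn, hurwitzQuot]
  by_cases h : (n : ℤ) ^ 2 ∣ Δ
  · rw [if_pos h, if_pos h, if_pos (h.mul_left _), Int.mul_ediv_assoc _ h]
    exact hurwitzClassNumber_sub_prime_sq_mul hp (ediv_sq_neg hΔ h)
  · rw [if_neg h, if_neg h, if_neg (fun hc => h ((sq_dvd_prime_sq_mul_iff hp hn).mp hc))]

/-- If `(e / p) = χ` for all discriminants `e` in the square class of `Δ`, and `p` does not divide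
the conductor of `Δ`, then `H(p² Δ) - p H(Δ) = (1 - χ) H(Δ)`. -/
lemma hurwitzQuot_sub_of_kronecker {p n : ℕ} (hp : p.Prime) (hn : ¬ p ∣ n) {Δ : ℤ} (hΔ : Δ < 0)
    (hd : Δ % 4 = 0 ∨ Δ % 4 = 1) {χ : ℤ}
    (hχ : ∀ f e : ℤ, f ^ 2 * e = Δ → (e % 4 = 0 ∨ e % 4 = 1) →
      ¬ (p : ℤ) ∣ f ∧ kroneckerPrime e p = χ) :
    hurwitzQuot ((p : ℤ) ^ 2 * Δ) n - p * hurwitzQuot Δ n = (1 - (χ : ℝ)) * hurwitzQuot Δ n := by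
  rw [hurwitzQuot_prime_sq_mul hp hn, hurwitzQuot]
  by_cases h : (n : ℤ) ^ 2 ∣ Δ
  · rw [if_pos h, if_pos h]
    have h1 := Int.mul_ediv_cancel' h
    refine hurwitzClassNumber_sub_of_kronecker hp (ediv_sq_neg hΔ h) ?_ fun f e hfe he => ?_
    · rcases eq_or_ne p 2 with rfl | hp2
      · left
        rwa [← odd_sq_mul_emod_four (n := (n : ℤ)) (fun hc => hn (by exact_mod_cast hc)), h1]
      · exact Or.inr hp2
    · obtain ⟨h2, h3⟩ := hχ (n * f) e (by rw [mul_pow, mul_assoc, hfe, h1]) he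
      exact ⟨fun hc => h2 (hc.mul_left _), h3⟩
  · rw [if_neg h, if_neg h]
    ring

end Hurwitz

/-! ### Class numbers of supersingular discriminants -/

section Supersingular

lemma eq_one_of_sq_lt_four {n : ℕ} (h0 : 0 < n) (h : (n : ℤ) ^ 2 < 4) : n = 1 := by
  have : (n : ℤ) < 2 := by nlinarith
  omega

lemma hurwitzClassNumber_eq_weighted {Δ : ℤ} (hΔ : Δ ≠ 0)
    (h : ∀ f : ℕ, f ≠ 1 → (f : ℤ) ^ 2 ∣ Δ → weightedClassNumber (Δ / (f : ℤ) ^ 2) = 0) :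
    hurwitzClassNumber Δ = weightedClassNumber Δ := by
  rw [hurwitzClassNumber_eq_sum, Finset.sum_eq_single 1]
  · simp
  · intro f hf hf1
    exact h f hf1 ((mem_squareDivisors hΔ).mp hf)
  · intro hf
    exact absurd ((mem_squareDivisors hΔ).mpr (by simp)) hf

lemma hurwitzQuot_one (Δ : ℤ) : hurwitzQuot Δ 1 = hurwitzClassNumber Δ := by
  rw [hurwitzQuot, if_pos (by simp)]
  simp

lemma hurwitzClassNumber_neg_three : hurwitzClassNumber (-3) = 1 / 3 := by
  rw [hurwitzClassNumber_eq_weighted (by norm_num), weightedClassNumber_neg_three]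
  intro f hf hd
  have h0 := pos_of_sq_dvd (by norm_num) hd
  have := Int.le_of_dvd (by norm_num) (dvd_neg.mpr hd)
  exact absurd (eq_one_of_sq_lt_four h0 (by omega)) hf

lemma hurwitzQuot_neg_three {n : ℕ} (hn : n ≠ 1) : hurwitzQuot (-3) n = 0 := by
  rw [hurwitzQuot, if_neg]
  intro hd
  have h0 := pos_of_sq_dvd (by norm_num) hd
  have := Int.le_of_dvd (by norm_num) (dvd_neg.mpr hd)
  exact hn (eq_one_of_sq_lt_four h0 (by omega))

lemma eq_two_of_sq_dvd_four {n : ℕ} (hn : n ≠ 1) (h : (n : ℤ) ^ 2 ∣ 4) : n = 2 := by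
  have h0 := pos_of_sq_dvd (by norm_num) h
  have := Int.le_of_dvd (by norm_num) h
  have : (n : ℤ) < 3 := by nlinarith
  omega

lemma hurwitzClassNumber_neg_four : hurwitzClassNumber (-4) = 1 / 2 := by
  rw [hurwitzClassNumber_eq_weighted (by norm_num), weightedClassNumber_neg_four]
  intro f hf hd
  rw [eq_two_of_sq_dvd_four hf (dvd_neg.mpr hd)]
  exact weightedClassNumber_eq_zero (by norm_num)

lemma hurwitzClassNumber_neg_one : hurwitzClassNumber (-1) = 0 := by
  rw [hurwitzClassNumber_eq_weighted (by norm_num), weightedClassNumber_eq_zero (by norm_num)]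
  intro f hf hd
  have h0 := pos_of_sq_dvd (by norm_num) hd
  have := Int.le_of_dvd (by norm_num) (dvd_neg.mpr hd)
  exact absurd (eq_one_of_sq_lt_four h0 (by omega)) hf

lemma hurwitzQuot_neg_four {n : ℕ} (hn : n ≠ 1) : hurwitzQuot (-4) n = 0 := by
  rw [hurwitzQuot]
  split_ifs with hd
  · rw [eq_two_of_sq_dvd_four hn (dvd_neg.mpr hd)]
    exact hurwitzClassNumber_neg_one
  · rfl

lemma hurwitzQuot_neg_four_mul_two {p : ℕ} (hp : p.Prime) :
    hurwitzQuot (-4 * (p : ℤ)) 2 = weightedClassNumber (-(p : ℤ)) := by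
  have hp0 : (p : ℤ) ≠ 0 := by exact_mod_cast hp.ne_zero
  have h1 : -4 * (p : ℤ) = ((2 : ℕ) : ℤ) ^ 2 * (-p) := by push_cast; ring
  rw [hurwitzQuot, if_pos ⟨_, h1⟩, h1, Int.mul_ediv_cancel_left _ (by norm_num),
    hurwitzClassNumber_eq_weighted (neg_ne_zero.mpr hp0)]
  intro f hf hd
  have hf2 : f * f ∣ p := by
    have := dvd_neg.mp hd
    rw [sq] at this
    exact_mod_cast this
  exact absurd (Nat.isUnit_iff.mp (hp.squarefree f hf2)) hf

lemma hurwitzQuot_neg_four_mul {p : ℕ} (hp : p.Prime) {n : ℕ} (hpn : ¬ p ∣ n) (hn : 2 < n) :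
    hurwitzQuot (-4 * (p : ℤ)) n = 0 := by
  rw [hurwitzQuot, if_neg]
  intro hd
  have h1 : IsCoprime ((n : ℤ) ^ 2) (p : ℤ) := IsCoprime.pow_left
    (Nat.isCoprime_iff_coprime.mpr ((Nat.Prime.coprime_iff_not_dvd hp).mpr hpn)).symm
  have h2 := eq_two_of_sq_dvd_four (by omega) (dvd_neg.mp (h1.dvd_of_dvd_mul_right hd))
  omega

/-- The value of `H(p² E) - p H(E)` for `E = (t² - 4 p ^ v) / n²` with `n` prime to `p`. It is
`(1 - (D / p)) H(D / n²)` if `t² - 4 p ^ v` is a square times one of the discriminants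
`D = -4, -3, -4p` in the cases listed here, the traces of supersingular elliptic curves, and zero
otherwise. -/
noncomputable def supersingularQuot (p v : ℕ) (t : ℤ) (n : ℕ) : ℝ :=
  open Classical in
  if Even v then
    if t = 0 then (1 - (kroneckerPrime (-4) p : ℝ)) * hurwitzQuot (-4) n
    else if t ^ 2 = (p : ℤ) ^ v then (1 - (kroneckerPrime (-3) p : ℝ)) * hurwitzQuot (-3) n
    else 0
  else
    if t = 0 then hurwitzQuot (-4 * (p : ℤ)) n
    else if t ^ 2 = 2 * (p : ℤ) ^ v ∧ p = 2 then hurwitzQuot (-4) n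
    else if t ^ 2 = 3 * (p : ℤ) ^ v ∧ p = 3 then hurwitzQuot (-3) n
    else 0

lemma supersingularQuot_add_two {p : ℕ} (hp : p.Prime) (v : ℕ) (s : ℤ) (n : ℕ) :
    supersingularQuot p (v + 2) (p * s) n = supersingularQuot p v s n := by
  have hp0 : (p : ℤ) ≠ 0 := by exact_mod_cast hp.ne_zero
  have hp2 : (p : ℤ) ^ 2 ≠ 0 := pow_ne_zero 2 hp0
  have h0 : (p : ℤ) * s = 0 ↔ s = 0 := by simp [hp.ne_zero]
  have hc : ∀ c : ℤ, ((p : ℤ) * s) ^ 2 = c * (p : ℤ) ^ (v + 2) ↔ s ^ 2 = c * (p : ℤ) ^ v := by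
    intro c
    rw [mul_pow, pow_add, ← mul_assoc, mul_comm _ ((p : ℤ) ^ 2), mul_right_inj' hp2]
  have h1 := hc 1
  rw [one_mul, one_mul] at h1
  have hev : Even (v + 2) ↔ Even v := by simp [Nat.even_add]
  simp only [supersingularQuot, h0, h1, hc, hev]

lemma sq_ne_mul_prime_pow {p : ℕ} (hp : p.Prime) {v : ℕ} (hv : 1 ≤ v) {t c : ℤ}
    (ht : ¬ (p : ℤ) ∣ t) : t ^ 2 ≠ c * (p : ℤ) ^ v := by
  intro h
  refine ht ((Nat.prime_iff_prime_int.mp hp).dvd_of_dvd_pow (n := 2) ?_)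
  rw [h]
  exact (dvd_pow_self _ (by omega)).mul_left _

lemma supersingularQuot_of_not_dvd {p : ℕ} (hp : p.Prime) {v : ℕ} (hv : 1 ≤ v) {t : ℤ}
    (ht : ¬ (p : ℤ) ∣ t) (n : ℕ) : supersingularQuot p v t n = 0 := by
  have h0 : t ≠ 0 := fun hc => ht (hc ▸ dvd_zero _)
  have h1 := sq_ne_mul_prime_pow hp hv (c := 1) ht
  rw [one_mul] at h1
  simp [supersingularQuot, h0, h1, sq_ne_mul_prime_pow hp hv ht]

lemma trace_emod_four (t w : ℤ) : (t ^ 2 - 4 * w) % 4 = 0 ∨ (t ^ 2 - 4 * w) % 4 = 1 := by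
  rcases Int.even_or_odd' t with ⟨k, rfl | rfl⟩
  · left
    have : (2 * k) ^ 2 - 4 * w = 4 * (k ^ 2 - w) := by ring
    omega
  · right
    have : (2 * k + 1) ^ 2 - 4 * w = 4 * (k ^ 2 + k - w) + 1 := by ring
    omega

/-- For ordinary traces the discriminant is a square modulo `4p` prime to `p`, so that `p` splits
and the two class numbers cancel. -/
lemma hurwitzQuot_sub_of_not_dvd {p n : ℕ} (hp : p.Prime) (hn : ¬ p ∣ n) {v : ℕ} (hv : 1 ≤ v)
    {t : ℤ} (ht : ¬ (p : ℤ) ∣ t) (hlt : t ^ 2 < 4 * (p : ℤ) ^ v) :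
    hurwitzQuot ((p : ℤ) ^ 2 * (t ^ 2 - 4 * (p : ℤ) ^ v)) n
      - p * hurwitzQuot (t ^ 2 - 4 * (p : ℤ) ^ v) n = 0 := by
  obtain ⟨w, rfl⟩ : ∃ w, v = w + 1 := ⟨v - 1, by omega⟩
  rw [hurwitzQuot_sub_of_kronecker hp hn (by omega) (trace_emod_four _ _) (χ := 1)]
  · simp
  · intro f e hfe _
    refine ⟨fun hf => ht ((Nat.prime_iff_prime_int.mp hp).dvd_of_dvd_pow (n := 2) ?_),
      kroneckerPrime_eq_one hp ht (w := (p : ℤ) ^ w) (by rw [hfe]; ring)⟩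
    rw [show t ^ 2 = f * (f * e) + p * (4 * (p : ℤ) ^ w) by linear_combination -hfe]
    exact dvd_add (hf.mul_right _) (dvd_mul_right _ _)

lemma int_not_dvd_of_sq_eq_one {p : ℕ} (hp : p.Prime) {f : ℤ} (hf : f ^ 2 = 1) :
    ¬ (p : ℤ) ∣ f := fun h =>
  (Nat.prime_iff_prime_int.mp hp).not_dvd_one (hf ▸ h.trans (dvd_pow_self f two_ne_zero))

lemma hurwitzQuot_sub_neg_three {p n : ℕ} (hp : p.Prime) (hn : ¬ p ∣ n) :
    hurwitzQuot ((p : ℤ) ^ 2 * (-3)) n - p * hurwitzQuot (-3) n =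
      (1 - (kroneckerPrime (-3) p : ℝ)) * hurwitzQuot (-3) n := by
  refine hurwitzQuot_sub_of_kronecker hp hn (by norm_num) (by norm_num) fun f e hfe _ => ?_
  have he : e < 0 := by nlinarith [sq_nonneg f]
  have hf : 0 < f ^ 2 := by
    rcases (sq_nonneg f).lt_or_eq with h | h
    · exact h
    · rw [← h] at hfe; omega
  have h3 : f ^ 2 ≤ 3 := by nlinarith
  have hf1 : f ^ 2 = 1 := by
    have h4 : f ≤ 1 := by nlinarith
    have h5 : -1 ≤ f := by nlinarith
    interval_cases f <;> simp_all
  refine ⟨int_not_dvd_of_sq_eq_one hp hf1, ?_⟩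
  rw [hf1, one_mul] at hfe
  rw [hfe]

lemma hurwitzQuot_sub_neg_four {p n : ℕ} (hp : p.Prime) (hn : ¬ p ∣ n) :
    hurwitzQuot ((p : ℤ) ^ 2 * (-4)) n - p * hurwitzQuot (-4) n =
      (1 - (kroneckerPrime (-4) p : ℝ)) * hurwitzQuot (-4) n := by
  refine hurwitzQuot_sub_of_kronecker hp hn (by norm_num) (by norm_num) fun f e hfe hed => ?_
  have he : e < 0 := by nlinarith [sq_nonneg f]
  have hf : 0 < f ^ 2 := by
    rcases (sq_nonneg f).lt_or_eq with h | h
    · exact h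
    · rw [← h] at hfe; omega
  have h3 : f ^ 2 ≤ 4 := by nlinarith
  have hf1 : f ^ 2 = 1 := by
    have h4 : f ≤ 2 := by nlinarith
    have h5 : -2 ≤ f := by nlinarith
    interval_cases f <;> first | rfl | (exfalso; omega)
  refine ⟨int_not_dvd_of_sq_eq_one hp hf1, ?_⟩
  rw [hf1, one_mul] at hfe
  rw [hfe]

lemma hurwitzQuot_sub_neg_four_mul {p n : ℕ} (hp : p.Prime) (hn : ¬ p ∣ n) :
    hurwitzQuot ((p : ℤ) ^ 2 * (-4 * (p : ℤ))) n - p * hurwitzQuot (-4 * (p : ℤ)) n =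
      hurwitzQuot (-4 * (p : ℤ)) n := by
  have hp0 : 0 < (p : ℤ) := by exact_mod_cast hp.pos
  have hpp : Prime (p : ℤ) := Nat.prime_iff_prime_int.mp hp
  rw [hurwitzQuot_sub_of_kronecker hp hn (by omega) (by omega) (χ := 0)]
  · simp
  · intro f e hfe hed
    have hf : ¬ (p : ℤ) ∣ f := by
      rintro ⟨g, rfl⟩
      have h1 : (p : ℤ) * (g ^ 2 * e) = -4 := by
        apply mul_left_cancel₀ hp0.ne'
        linear_combination hfe
      have h2 : (p : ℤ) ∣ 2 ^ 2 := ⟨-(g ^ 2 * e), by linear_combination h1⟩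
      have h3 : p ∣ 2 := by exact_mod_cast hpp.dvd_of_dvd_pow h2
      obtain rfl : p = 2 := (Nat.prime_dvd_prime_iff_eq hp Nat.prime_two).mp h3
      have h4 : g ^ 2 * e = -2 := by push_cast at h1; omega
      have he : e < 0 := by nlinarith [sq_nonneg g]
      have hg2 : g ^ 2 ≤ 2 := by nlinarith [sq_nonneg g]
      have h5 : g ≤ 1 := by nlinarith
      have h6 : -1 ≤ g := by nlinarith
      interval_cases g <;> omega
    refine ⟨hf, kroneckerPrime_eq_zero hp ?_⟩
    have h1 : (p : ℤ) ∣ f ^ 2 * e := ⟨-4, by rw [hfe]; ring⟩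
    exact (hpp.dvd_or_dvd h1).resolve_left fun hc => hf (hpp.dvd_of_dvd_pow hc)

/-- The traces divisible by `p` over the prime field. -/
lemma trace_eq_of_dvd {p : ℕ} (hp : p.Prime) {t : ℤ} (ht : (p : ℤ) ∣ t)
    (hlt : t ^ 2 < 4 * (p : ℤ)) :
    t = 0 ∨ (p = 2 ∧ t ^ 2 = 4) ∨ (p = 3 ∧ t ^ 2 = 9) := by
  obtain ⟨s, rfl⟩ := ht
  have hp0 : 2 ≤ (p : ℤ) := by exact_mod_cast hp.two_le
  have h1 : (p : ℤ) * s ^ 2 < 4 := by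
    by_contra hcon
    nlinarith
  have h2 : s ^ 2 < 2 := by nlinarith [sq_nonneg s]
  have h5 : s ≤ 1 := by nlinarith
  have h6 : -1 ≤ s := by nlinarith
  obtain rfl | h : s = 0 ∨ s ^ 2 = 1 := by interval_cases s <;> simp
  · left; simp
  · right
    rw [h] at h1
    have : p = 2 ∨ p = 3 := by omega
    rcases this with rfl | rfl
    · left; exact ⟨rfl, by rw [mul_pow, h]; norm_num⟩
    · right; exact ⟨rfl, by rw [mul_pow, h]; norm_num⟩

lemma supersingularQuot_one {p : ℕ} (hp : p.Prime) {t : ℤ} (ht : (p : ℤ) ∣ t)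
    (hlt : t ^ 2 < 4 * (p : ℤ)) (n : ℕ) :
    supersingularQuot p 1 t n = hurwitzQuot (t ^ 2 - 4 * (p : ℤ)) n := by
  rcases trace_eq_of_dvd hp ht hlt with rfl | ⟨rfl, h⟩ | ⟨rfl, h⟩
  · simp [supersingularQuot]
  · have h0 : t ≠ 0 := by rintro rfl; norm_num at h
    rw [h]
    simp [supersingularQuot, h0, h]
  · have h0 : t ≠ 0 := by rintro rfl; norm_num at h
    rw [h]
    simp [supersingularQuot, h0, h]

lemma hurwitzQuot_sub_eq_supersingularQuot {p n : ℕ} (hp : p.Prime) (hn : ¬ p ∣ n) (v : ℕ) :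
    ∀ t : ℤ, t ^ 2 < 4 * (p : ℤ) ^ v →
      hurwitzQuot ((p : ℤ) ^ 2 * (t ^ 2 - 4 * (p : ℤ) ^ v)) n
        - p * hurwitzQuot (t ^ 2 - 4 * (p : ℤ) ^ v) n = supersingularQuot p v t n := by
  induction v using Nat.twoStepInduction with
  | zero =>
    intro t ht
    rw [pow_zero, mul_one] at ht ⊢
    have h5 : t ≤ 1 := by nlinarith
    have h6 : -1 ≤ t := by nlinarith
    obtain rfl | h : t = 0 ∨ t ^ 2 = 1 := by interval_cases t <;> simp
    · simpa [supersingularQuot] using hurwitzQuot_sub_neg_four hp hn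
    · have h0 : t ≠ 0 := by rintro rfl; norm_num at h
      rw [h]
      simpa [supersingularQuot, h0, h] using hurwitzQuot_sub_neg_three hp hn
  | one =>
    intro t ht
    rw [pow_one] at ht ⊢
    by_cases hpt : (p : ℤ) ∣ t
    · rw [supersingularQuot_one hp hpt ht]
      rcases trace_eq_of_dvd hp hpt ht with rfl | ⟨rfl, h⟩ | ⟨rfl, h⟩
      · simpa using hurwitzQuot_sub_neg_four_mul hp hn
      · rw [h]
        have := hurwitzQuot_sub_neg_four hp hn
        rw [kroneckerPrime_eq_zero hp (by norm_num)] at this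
        simpa using this
      · rw [h]
        have := hurwitzQuot_sub_neg_three hp hn
        rw [kroneckerPrime_eq_zero hp (by norm_num)] at this
        simpa using this
    · rw [supersingularQuot_of_not_dvd hp le_rfl hpt]
      simpa using hurwitzQuot_sub_of_not_dvd hp hn le_rfl hpt (by simpa using ht)
  | more v ih _ =>
    intro t ht
    by_cases hpt : (p : ℤ) ∣ t
    · obtain ⟨s, rfl⟩ := hpt
      have hp2 : 0 < (p : ℤ) ^ 2 := pow_pos (by exact_mod_cast hp.pos) 2
      have hfac : ((p : ℤ) * s) ^ 2 - 4 * (p : ℤ) ^ (v + 2) =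
          (p : ℤ) ^ 2 * (s ^ 2 - 4 * (p : ℤ) ^ v) := by ring
      have hs : s ^ 2 < 4 * (p : ℤ) ^ v := by
        have h1 : (p : ℤ) ^ 2 * (s ^ 2 - 4 * (p : ℤ) ^ v) < 0 := by rw [← hfac]; omega
        have := neg_of_mul_neg_right h1 hp2.le
        omega
      rw [hfac, hurwitzQuot_sub_prime_sq_mul hp hn (by omega), ih s hs,
        supersingularQuot_add_two hp]
    · rw [supersingularQuot_of_not_dvd hp (by omega) hpt]
      exact hurwitzQuot_sub_of_not_dvd hp hn (by omega) hpt ht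

end Supersingular

/-! ### The combination of local conditions -/

section ClassNumberComb

/-- The combination of local conditions in the definition of `H_{n₁,n₂}(t, q, d)`, as a linear
functional in the function `g n = H((t² - 4q) / n²)`. -/
noncomputable def classNumberComb (n₁ n₂ : ℕ) (g : ℕ → ℝ) (t : ℤ) (q : ℕ) (d : ℤ) : ℝ :=
  open Classical in
  1 / 2 * g n₂ * deltaMod n₂ (d ^ 2 * q) 1 * indD q d t (n₁ * n₂)
  + ∑ m ∈ n₁.divisors.filter (fun m => IsFullDivisor m n₁ ∧ 2 ≤ m),
      ∑ μ ∈ n₁.divisors.filter (fun μ => Prec n₁ n₂ μ m),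
        (-1 : ℝ) ^ m.primeFactors.card * (1 / 2 * g (n₂ * μ))
          * deltaMod (n₂ * μ) (d ^ 2 * q) 1 * localFactors n₁ n₂ m μ q d t

lemma classNumberH_eq_comb (n₁ n₂ : ℕ) (t : ℤ) (q : ℕ) (d : ℤ) :
    classNumberH n₁ n₂ t q d = classNumberComb n₁ n₂ (hurwitzQuot (t ^ 2 - 4 * q)) t q d := rfl

lemma classNumberComb_sub (n₁ n₂ : ℕ) (g h : ℕ → ℝ) (c : ℝ) (t : ℤ) (q : ℕ) (d : ℤ) :
    classNumberComb n₁ n₂ g t q d - c * classNumberComb n₁ n₂ h t q d =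
      classNumberComb n₁ n₂ (fun n => g n - c * h n) t q d := by
  classical
  simp only [classNumberComb, mul_add, Finset.mul_sum]
  rw [add_sub_add_comm, ← Finset.sum_sub_distrib]
  congr 1
  · ring
  · refine Finset.sum_congr rfl fun m _ => ?_
    rw [← Finset.sum_sub_distrib]
    exact Finset.sum_congr rfl fun μ _ => by ring

lemma not_dvd_of_mem_primeFactors {p n ℓ : ℕ} (hp : p.Prime) (hn : ¬ p ∣ n) (e : ℕ)
    (hℓ : ℓ ∈ n.primeFactors) : ¬ p ∣ ℓ ^ e := fun h =>
  hn ((hp.dvd_of_dvd_pow h).trans (Nat.dvd_of_mem_primeFactors hℓ))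

/-- Only arguments prime to `p` matter in `classNumberComb`. -/
lemma classNumberComb_congr {p n₁ n₂ : ℕ} (hp : p.Prime) (h₁ : ¬ p ∣ n₁) (h₂ : ¬ p ∣ n₂)
    {g h : ℕ → ℝ} (hgh : ∀ n, ¬ p ∣ n → g n = h n) (t : ℤ) (q : ℕ) (d : ℤ) :
    classNumberComb n₁ n₂ g t q d = classNumberComb n₁ n₂ h t q d := by
  classical
  simp only [classNumberComb]
  rw [hgh n₂ h₂]
  congr 1
  refine Finset.sum_congr rfl fun m _ => Finset.sum_congr rfl fun μ hμ => ?_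
  have hμ' : ¬ p ∣ μ := fun hc =>
    h₁ (hc.trans (Nat.dvd_of_mem_divisors (Finset.mem_filter.mp hμ).1))
  rw [hgh (n₂ * μ) (fun hc => (hp.dvd_mul.mp hc).elim h₂ hμ')]

/-- Multiplication by `p` turns `p q + p⁻¹ ≡ s` into `p² q + 1 ≡ p s`. -/
lemma indD_prime_sq_mul {p : ℕ} (hp : p.Prime) {n : ℕ} (hn : ¬ p ∣ n) (q : ℕ) (s : ℤ) :
    indD q (p : ℤ) s n = indD (p ^ 2 * q) 1 (p * s) n := by
  have hu : (p : ZMod n) * (p : ZMod n)⁻¹ = 1 :=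
    ZMod.coe_mul_inv_eq_one p ((Nat.Prime.coprime_iff_not_dvd hp).mpr hn)
  rw [indD, indD]
  congr 1
  push_cast
  rw [ZMod.inv_one]
  refine propext ⟨fun h => ?_, fun h => ?_⟩
  · linear_combination (p : ZMod n) * h - hu
  · linear_combination (p : ZMod n)⁻¹ * h + (s - p * q) * hu

/-- The local conditions for the trace `s`, the prime power `q` and `d = p` are those for `p s`,
`p² q` and `d = 1`. -/
lemma classNumberComb_prime_sq_mul {p n₁ n₂ : ℕ} (hp : p.Prime) (h₁ : ¬ p ∣ n₁) (h₂ : ¬ p ∣ n₂)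
    (g : ℕ → ℝ) (s : ℤ) (q : ℕ) :
    classNumberComb n₁ n₂ g s q p = classNumberComb n₁ n₂ g (p * s) (p ^ 2 * q) 1 := by
  classical
  simp only [classNumberComb, localFactors]
  have hδ : ∀ n : ℕ, deltaMod n ((p : ℤ) ^ 2 * q) 1 =
      deltaMod n (1 ^ 2 * ((p ^ 2 * q : ℕ) : ℤ)) 1 := fun n => by push_cast; rw [one_mul]
  rw [hδ, indD_prime_sq_mul hp (fun hc => (hp.dvd_mul.mp hc).elim h₁ h₂)]
  congr 1
  refine Finset.sum_congr rfl fun m hm => Finset.sum_congr rfl fun μ hμ => ?_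
  have hm' : ¬ p ∣ m := fun hc =>
    h₁ (hc.trans (Nat.dvd_of_mem_divisors (Finset.mem_filter.mp hm).1))
  rw [hδ]
  congr 2
  · refine Finset.prod_congr rfl fun ℓ hℓ => ?_
    rw [indD_prime_sq_mul hp (not_dvd_of_mem_primeFactors hp hm' _ hℓ),
      indD_prime_sq_mul hp (not_dvd_of_mem_primeFactors hp hm' _ hℓ)]
  · refine Finset.prod_congr rfl fun ℓ hℓ => ?_
    rw [indD_prime_sq_mul hp (not_dvd_of_mem_primeFactors hp h₁ _ (Finset.mem_sdiff.mp hℓ).1)]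

lemma indD_one_eq (q : ℕ) (t : ℤ) (n : ℕ) :
    indD q 1 t n = if (n : ℤ) ∣ q + 1 - t then 1 else 0 := by
  rw [indD]
  congr 1
  refine propext ?_
  rw [← ZMod.intCast_zmod_eq_zero_iff_dvd]
  push_cast
  rw [ZMod.inv_one, one_mul, sub_eq_zero]

lemma two_le_of_prec {n₁ n₂ μ m : ℕ} (hm : 2 ≤ m) (h : Prec n₁ n₂ μ m) : 2 ≤ μ := by
  have h1 : m.primeFactors.Nonempty := Nat.nonempty_primeFactors.mpr (by omega)
  rw [← h.2.1] at h1
  exact Nat.nonempty_primeFactors.mp h1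

/-- The value of `classNumberComb` on a function supported at `1`. -/
lemma classNumberComb_of_support_one {n₁ n₂ : ℕ} (h₂ : n₂ ≠ 0) {g : ℕ → ℝ}
    (hg : ∀ n, 2 ≤ n → g n = 0) (t : ℤ) (q : ℕ) :
    classNumberComb n₁ n₂ g t q 1 = if n₂ = 1 then 1 / 2 * g 1 * indD q 1 t n₁ else 0 := by
  classical
  rw [classNumberComb, Finset.sum_eq_zero, add_zero]
  · split_ifs with h
    · subst h
      simp [deltaMod, Int.modEq_one]
    · rw [hg n₂ (by omega)]
      ring
  · intro m hm
    refine Finset.sum_eq_zero fun μ hμ => ?_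
    have := two_le_of_prec (Finset.mem_filter.mp hm).2.2 (Finset.mem_filter.mp hμ).2
    rw [hg (n₂ * μ) (by nlinarith [Nat.pos_of_ne_zero h₂])]
    ring

lemma prod_indD_one {s : Finset ℕ} {e : ℕ → ℕ} (hs : ∀ ℓ ∈ s, ℓ.Prime) (q : ℕ) (t : ℤ) :
    ∏ ℓ ∈ s, indD q 1 t (ℓ ^ e ℓ) = indD q 1 t (∏ ℓ ∈ s, ℓ ^ e ℓ) := by
  simp only [indD_one_eq]
  rw [Finset.prod_boole]
  congr 1
  refine propext ⟨fun h => ?_, fun h ℓ hℓ => ?_⟩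
  · push_cast
    refine Finset.prod_dvd_of_coprime (fun a ha b hb hab => ?_) (fun ℓ hℓ => by
      have := h ℓ hℓ; push_cast at this; exact this)
    exact (Nat.isCoprime_iff_coprime.mpr
      ((Nat.coprime_primes (hs a ha) (hs b hb)).mpr hab)).pow
  · refine dvd_trans ?_ h
    exact_mod_cast Finset.dvd_prod_of_mem (fun ℓ => ℓ ^ e ℓ) hℓ

lemma prod_primeFactors_sdiff_two {n : ℕ} (hn : n ≠ 0) (h2 : 2 ∣ n) :
    2 ^ n.factorization 2 * ∏ ℓ ∈ n.primeFactors \ {2}, ℓ ^ n.factorization ℓ = n := by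
  have h := Nat.prod_factorization_pow_eq_self hn
  rw [Finsupp.prod, Nat.support_factorization] at h
  conv_rhs => rw [← h]
  rw [← Finset.mul_prod_erase _ _
    (Nat.mem_primeFactors.mpr ⟨Nat.prime_two, h2, hn⟩), Finset.erase_eq]

lemma indD_one_mul {a b : ℕ} (h : a.Coprime b) (q : ℕ) (t : ℤ) :
    indD q 1 t (a * b) = indD q 1 t a * indD q 1 t b := by
  simp only [indD_one_eq]
  rw [ite_zero_mul_ite_zero, one_mul]
  congr 1
  push_cast
  exact propext ⟨fun hd => ⟨(dvd_mul_right _ _).trans hd, (dvd_mul_left _ _).trans hd⟩,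
    fun hd => (Nat.isCoprime_iff_coprime.mpr h).mul_dvd hd.1 hd.2⟩

/-- The value of `classNumberComb` for `n₂ = 1` on a function supported at `1` and `2`: besides the
main term only `m = 2 ^ v₂(n₁)` and `μ = 2` contribute. -/
lemma classNumberComb_of_support_two {n₁ : ℕ} (h₁ : n₁ ≠ 0) {g : ℕ → ℝ} (q : ℕ)
    (hg : ∀ n, n ∣ n₁ → 2 < n → g n = 0) (hq : 4 ∣ n₁ → ¬ 2 ∣ q) (t : ℤ) :
    classNumberComb n₁ 1 g t q 1 = 1 / 2 * g 1 * indD q 1 t n₁ -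
      deltaMod 4 n₁ 0 * (1 / 2) * g 2 * (indD q 1 t n₁ - indD q 1 t (2 * n₁)) := by
  classical
  have hδ4 : deltaMod 4 n₁ 0 = if 4 ∣ n₁ then 1 else 0 := by
    rw [deltaMod]
    congr 1
    rw [Int.modEq_zero_iff_dvd]
    exact propext (by norm_cast)
  have hμ2 : ∀ m ∈ n₁.divisors.filter (fun m => IsFullDivisor m n₁ ∧ 2 ≤ m),
      ∀ μ ∈ n₁.divisors.filter (fun μ => Prec n₁ 1 μ m), μ ≠ 2 → g μ = 0 := by
    intro m hm μ hμ hne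
    have := two_le_of_prec (Finset.mem_filter.mp hm).2.2 (Finset.mem_filter.mp hμ).2
    exact hg μ (Nat.dvd_of_mem_divisors (Finset.mem_filter.mp hμ).1) (by omega)
  rw [classNumberComb, sub_eq_add_neg]
  congr 1
  · simp [deltaMod, Int.modEq_one]
  rw [hδ4]
  split_ifs with h4
  · set a := n₁.factorization 2 with ha
    have h2 : 2 ∣ n₁ := dvd_trans (by norm_num) h4
    have ha2 : 2 ≤ a := (Nat.prime_two.pow_dvd_iff_le_factorization h₁).mp h4
    have hdvd : 2 ^ a ∣ n₁ := Nat.ordProj_dvd n₁ 2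
    have hpf : (2 ^ a).primeFactors = {2} := Nat.primeFactors_prime_pow (by omega) Nat.prime_two
    have hm : 2 ^ a ∈ n₁.divisors.filter (fun m => IsFullDivisor m n₁ ∧ 2 ≤ m) := by
      rw [Finset.mem_filter, Nat.mem_divisors]
      refine ⟨⟨hdvd, h₁⟩, ⟨hdvd, fun ℓ hℓ => ?_⟩, ?_⟩
      · rw [hpf, Finset.mem_singleton] at hℓ
        subst hℓ
        simp [Nat.prime_two.factorization_pow, ha]
      · exact (Nat.le_self_pow (by omega) 2)
    have hprec : Prec n₁ 1 2 (2 ^ a) := by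
      refine ⟨two_ne_zero, by rw [hpf, Nat.prime_two.primeFactors], fun ℓ hℓ => ?_⟩
      rw [hpf, Finset.mem_singleton] at hℓ
      subst hℓ
      rw [Nat.div_one, ← ha, Nat.prime_two.factorization_self]
      omega
    have hμ : 2 ∈ n₁.divisors.filter (fun μ => Prec n₁ 1 μ (2 ^ a)) :=
      Finset.mem_filter.mpr ⟨Nat.mem_divisors.mpr ⟨h2, h₁⟩, hprec⟩
    rw [Finset.sum_eq_single_of_mem _ hm, Finset.sum_eq_single_of_mem _ hμ]
    · have hf2 : (n₁ * 1 * 2).factorization 2 = a + 1 := by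
        rw [mul_one, Nat.factorization_mul h₁ two_ne_zero, Finsupp.add_apply,
          Nat.prime_two.factorization_self]
      have hδ2 : deltaMod (1 * 2) (1 ^ 2 * (q : ℤ)) 1 = 1 := by
        rw [deltaMod, if_pos]
        have hodd := hq h4
        rw [one_pow, one_mul, one_mul]
        change (q : ℤ) % 2 = 1 % 2
        omega
      have hc : ∀ k : ℕ, Nat.Coprime (2 ^ k) (∏ ℓ ∈ n₁.primeFactors \ {2},
          ℓ ^ n₁.factorization ℓ) := by
        intro k
        refine Nat.Coprime.prod_right fun ℓ hℓ => Nat.Coprime.pow _ _ ?_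
        rw [Finset.mem_sdiff, Finset.mem_singleton] at hℓ
        exact (Nat.coprime_primes Nat.prime_two (Nat.prime_of_mem_primeFactors hℓ.1)).mpr
          (Ne.symm hℓ.2)
      have hn := prod_primeFactors_sdiff_two h₁ h2
      rw [← ha] at hn
      have hn2 : 2 ^ (a + 1) * ∏ ℓ ∈ n₁.primeFactors \ {2}, ℓ ^ n₁.factorization ℓ = 2 * n₁ := by
        rw [pow_succ', mul_assoc, hn]
      have h1 := indD_one_mul (hc a) q t
      have h3 := indD_one_mul (hc (a + 1)) q t
      rw [hn] at h1
      rw [hn2] at h3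
      rw [localFactors, hpf, Finset.card_singleton, Finset.prod_singleton, hf2, hδ2,
        Nat.add_sub_cancel, mul_one n₁, prod_indD_one
          (fun ℓ hℓ => Nat.prime_of_mem_primeFactors (Finset.mem_sdiff.mp hℓ).1), h1, h3]
      ring_nf
    · intro μ hμ' hne
      rw [one_mul, hμ2 _ hm μ hμ' hne]
      ring
    · intro m hm' hne
      refine Finset.sum_eq_zero fun μ hμ' => ?_
      have hμne : μ ≠ 2 := by
        rintro rfl
        refine hne ?_
        have hmf := (Finset.mem_filter.mp hm')
        have hpm : m.primeFactors = {2} := by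
          rw [← (Finset.mem_filter.mp hμ').2.2.1, Nat.prime_two.primeFactors]
        have h5 := Nat.prod_factorization_pow_eq_self (n := m) (by omega)
        rw [Finsupp.prod, Nat.support_factorization, hpm, Finset.prod_singleton,
          hmf.2.1.2 2 (by rw [hpm]; exact Finset.mem_singleton_self 2)] at h5
        exact h5.symm
      rw [one_mul, hμ2 m hm' μ hμ' hμne]
      ring
  · rw [Finset.sum_eq_zero]
    · ring
    · intro m hm
      refine Finset.sum_eq_zero fun μ hμ => ?_
      have hμne : μ ≠ 2 := by
        rintro rfl
        have hP := (Finset.mem_filter.mp hμ).2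
        have h2m : 2 ∈ m.primeFactors := by
          rw [← hP.2.1, Nat.prime_two.primeFactors]
          exact Finset.mem_singleton_self 2
        have h5 := hP.2.2 2 h2m
        rw [Nat.div_one, Nat.prime_two.factorization_self] at h5
        exact h4 ((Nat.prime_two.pow_dvd_iff_le_factorization h₁).mpr h5)
      rw [one_mul, hμ2 m hm μ hμ hμne]
      ring

/-- The value of `classNumberComb` for `n₂ ≥ 2` on a function that vanishes from `3` on. -/
lemma classNumberComb_of_two_le {n₁ n₂ : ℕ} (h₂ : 2 ≤ n₂) {g : ℕ → ℝ}
    (hg : ∀ m, m ∣ n₁ → 2 < n₂ * m → g (n₂ * m) = 0) (q : ℕ) (t : ℤ)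
    (hq : n₂ = 2 → ¬ 2 ∣ q) :
    classNumberComb n₁ n₂ g t q 1 =
      if n₂ = 2 then 1 / 2 * g 2 * indD q 1 t (2 * n₁) else 0 := by
  classical
  rw [classNumberComb, Finset.sum_eq_zero, add_zero]
  · split_ifs with h
    · subst h
      have hδ2 : deltaMod 2 (1 ^ 2 * (q : ℤ)) 1 = 1 := by
        rw [deltaMod, if_pos]
        have hodd := hq rfl
        rw [one_pow, one_mul]
        change (q : ℤ) % 2 = 1 % 2
        omega
      rw [hδ2, mul_one, mul_comm n₁]
    · have h1 := hg 1 (one_dvd _)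
      rw [mul_one] at h1
      rw [h1 (by omega)]
      ring
  · intro m hm
    refine Finset.sum_eq_zero fun μ hμ => ?_
    have := two_le_of_prec (Finset.mem_filter.mp hm).2.2 (Finset.mem_filter.mp hμ).2
    rw [hg μ (Nat.dvd_of_mem_divisors (Finset.mem_filter.mp hμ).1) (by nlinarith)]
    ring

end ClassNumberComb

/-! ### Comparison for a single trace -/

section SingleTrace

lemma supersingularQuot_eq_zero {p v n : ℕ} (hp : p.Prime) (hpn : ¬ p ∣ n) (hn : 2 < n) (t : ℤ) :
    supersingularQuot p v t n = 0 := by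
  simp only [supersingularQuot, hurwitzQuot_neg_three (n := n) (by omega),
    hurwitzQuot_neg_four (n := n) (by omega), hurwitzQuot_neg_four_mul hp hpn hn, mul_zero,
    ite_self]

lemma indD_two_mul_eq_zero {p v n : ℕ} (hp2 : ¬ 2 ∣ p) (hv : Even v) (hn : 2 ∣ n) :
    indD (p ^ v) 1 0 (2 * n) = 0 := by
  rw [indD_one_eq, if_neg]
  intro hd
  obtain ⟨w, rfl⟩ := hv
  obtain ⟨m, rfl⟩ := hn
  have h4 : (4 : ℤ) ∣ ((p ^ (w + w) : ℕ) : ℤ) + 1 - 0 :=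
    dvd_trans ⟨m, by push_cast; ring⟩ hd
  rw [sub_zero, ← two_mul, pow_mul'] at h4
  have hodd : Odd ((p ^ w : ℕ) : ℤ) := by
    rw [Int.odd_coe_nat]
    exact (Nat.odd_iff.mpr (by omega : p % 2 = 1)).pow
  have h8 := Int.eight_dvd_sq_sub_one_of_odd hodd
  push_cast at h4 h8
  omega

lemma not_two_dvd_prime_pow {p v n : ℕ} (hp : p.Prime) (hn : ¬ p ∣ n) (h2 : 2 ∣ n) :
    ¬ 2 ∣ p ^ v := fun h =>
  hn ((Nat.prime_dvd_prime_iff_eq Nat.prime_two hp).mp (Nat.prime_two.dvd_of_dvd_pow h) ▸ h2)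

/-- The local combination of the supersingular class numbers is `H*_{n₁,n₂}`. -/
lemma classNumberComb_supersingularQuot {p v n₁ n₂ : ℕ} (hp : p.Prime) (hn₁ : n₁ ≠ 0)
    (hn₂ : n₂ ≠ 0) (h₁ : ¬ p ∣ n₁) (h₂ : ¬ p ∣ n₂) (h12 : n₂ = 2 → 2 ∣ n₁) (t : ℤ) :
    classNumberComb n₁ n₂ (supersingularQuot p v t) t (p ^ v) 1 =
      classNumberHStar n₁ n₂ t p v 1 := by
  rcases Nat.lt_or_ge 1 n₂ with hlt | hle
  · rw [classNumberComb_of_two_le hlt]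
    · rcases eq_or_ne n₂ 2 with rfl | hne
      · rw [if_pos rfl, classNumberHStar, if_neg (by norm_num), if_pos rfl]
        by_cases ht : t = 0
        · subst ht
          rw [if_pos rfl]
          by_cases hv : Even v
          · have hp2 : ¬ 2 ∣ p := by simpa using not_two_dvd_prime_pow (v := 1) hp h₂ (dvd_refl 2)
            rw [indD_two_mul_eq_zero hp2 hv (h12 rfl)]
            ring
          · rw [supersingularQuot, if_neg hv, if_pos rfl, hurwitzQuot_neg_four_mul_two hp]
        · rw [if_neg ht]
          have h0 : supersingularQuot p v t 2 = 0 := by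
            simp [supersingularQuot, ht, hurwitzQuot_neg_three, hurwitzQuot_neg_four]
          rw [h0]
          ring
      · rw [if_neg hne, classNumberHStar, if_pos (by omega)]
    · intro m hm hlt
      refine supersingularQuot_eq_zero hp (fun hc => ?_) hlt t
      exact (hp.dvd_mul.mp hc).elim h₂ (fun hc => h₁ (hc.trans hm))
    · rintro rfl
      exact not_two_dvd_prime_pow hp h₂ (dvd_refl 2)
  · obtain rfl : n₂ = 1 := by omega
    rw [classNumberHStar, if_neg (by norm_num), if_neg (by norm_num)]
    by_cases hv : Even v
    · rw [classNumberComb_of_support_one one_ne_zero, if_pos rfl, if_pos hv]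
      · simp only [supersingularQuot, if_pos hv]
        split_ifs
        · rw [hurwitzQuot_one, hurwitzClassNumber_neg_four]; ring
        · rw [hurwitzQuot_one, hurwitzClassNumber_neg_three]; ring
        · ring
      · intro n hn
        simp [supersingularQuot, hv, hurwitzQuot_neg_three (n := n) (by omega),
          hurwitzQuot_neg_four (n := n) (by omega)]
    · rw [if_neg hv]
      by_cases ht : t = 0
      · subst ht
        rw [if_pos rfl, classNumberComb_of_support_two hn₁]
        · simp only [supersingularQuot, if_neg hv, if_true]
          rw [hurwitzQuot_one, hurwitzQuot_neg_four_mul_two hp]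
        · intro n hn hlt
          exact supersingularQuot_eq_zero hp (fun hc => h₁ (hc.trans hn)) hlt 0
        · intro h4
          exact not_two_dvd_prime_pow hp h₁ (dvd_trans (by norm_num) h4)
      · rw [classNumberComb_of_support_one one_ne_zero, if_pos rfl, if_neg ht]
        · simp only [supersingularQuot, if_neg hv, if_neg ht]
          split_ifs
          · rw [hurwitzQuot_one, hurwitzClassNumber_neg_four]; ring
          · rw [hurwitzQuot_one, hurwitzClassNumber_neg_three]; ring
          · ring
        · intro n hn
          simp [supersingularQuot, hv, ht, hurwitzQuot_neg_three (n := n) (by omega),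
            hurwitzQuot_neg_four (n := n) (by omega)]

variable {p n₁ n₂ : ℕ}

lemma classNumberHStar_of_not_dvd (hp : p.Prime) {v : ℕ} (hv : 1 ≤ v) (hn₁ : n₁ ≠ 0)
    (hn₂ : n₂ ≠ 0) (h₁ : ¬ p ∣ n₁) (h₂ : ¬ p ∣ n₂) (h12 : n₂ = 2 → 2 ∣ n₁) {t : ℤ}
    (ht : ¬ (p : ℤ) ∣ t) : classNumberHStar n₁ n₂ t p v 1 = 0 := by
  rw [← classNumberComb_supersingularQuot hp hn₁ hn₂ h₁ h₂ h12]
  simp [classNumberComb, supersingularQuot_of_not_dvd hp hv ht]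

lemma classNumberH_prime (hp : p.Prime) (hn₁ : n₁ ≠ 0)
    (hn₂ : n₂ ≠ 0) (h₁ : ¬ p ∣ n₁) (h₂ : ¬ p ∣ n₂) (h12 : n₂ = 2 → 2 ∣ n₁) {t : ℤ}
    (ht : (p : ℤ) ∣ t) (hlt : t ^ 2 < 4 * (p : ℤ)) :
    classNumberH n₁ n₂ t (p ^ 1) 1 = classNumberHStar n₁ n₂ t p 1 1 := by
  rw [← classNumberComb_supersingularQuot hp hn₁ hn₂ h₁ h₂ h12, classNumberH_eq_comb]
  refine classNumberComb_congr hp h₁ h₂ (fun n _ => ?_) _ _ _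
  rw [supersingularQuot_one hp ht hlt, pow_one]

/-- The pointwise form of the comparison over traces divisible by `p`. -/
lemma classNumberH_sub_prime_sq (hp : p.Prime) {v : ℕ} (hn₁ : n₁ ≠ 0)
    (hn₂ : n₂ ≠ 0) (h₁ : ¬ p ∣ n₁) (h₂ : ¬ p ∣ n₂) (h12 : n₂ = 2 → 2 ∣ n₁) {s : ℤ}
    (hlt : s ^ 2 < 4 * (p : ℤ) ^ v) :
    classNumberH n₁ n₂ (p * s) (p ^ (v + 2)) 1 - p * classNumberH n₁ n₂ s (p ^ v) p =
      classNumberHStar n₁ n₂ (p * s) p (v + 2) 1 := by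
  rw [← classNumberComb_supersingularQuot hp hn₁ hn₂ h₁ h₂ h12, classNumberH_eq_comb,
    classNumberH_eq_comb, classNumberComb_prime_sq_mul hp h₁ h₂, ← pow_add, add_comm 2 v,
    classNumberComb_sub]
  refine classNumberComb_congr hp h₁ h₂ (fun n hn => ?_) _ _ _
  rw [supersingularQuot_add_two hp, ← hurwitzQuot_sub_eq_supersingularQuot hp hn v s hlt]
  push_cast
  congr 2
  ring

end SingleTrace

/-! ### Traces divisible by `p` -/

section Traces

lemma normChebyshev_prime_mul {p q : ℕ} (hp : p ≠ 0) (hq : q ≠ 0) (j : ℕ) (s : ℤ) :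
    normChebyshev j (p * s) (p ^ 2 * q) = (p : ℝ) ^ j * normChebyshev j s q := by
  have hp' : (p : ℝ) ≠ 0 := by exact_mod_cast hp
  have hq' : Real.sqrt q ≠ 0 := Real.sqrt_ne_zero'.mpr (by exact_mod_cast Nat.pos_of_ne_zero hq)
  have h : Real.sqrt ((p ^ 2 * q : ℕ) : ℝ) = p * Real.sqrt q := by
    push_cast
    rw [Real.sqrt_mul (by positivity), Real.sqrt_sq (by positivity)]
  rw [normChebyshev, normChebyshev, h, mul_pow, mul_assoc]
  congr 3
  push_cast
  field_simp

/-- Traces divisible by `p` for `p² q` are `p` times the traces for `q`. -/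
lemma sum_traceRange_filter_dvd {p q : ℕ} (hp : p ≠ 0) (F : ℤ → ℝ) :
    ∑ t ∈ (traceRange (p ^ 2 * q)).filter (fun t => (p : ℤ) ∣ t), F t =
      ∑ s ∈ traceRange q, F (p * s) := by
  have hp0 : (p : ℤ) ≠ 0 := by exact_mod_cast hp
  have hp2 : 0 < (p : ℤ) ^ 2 := by positivity
  have key : ∀ s : ℤ, (p : ℤ) * s ∈ traceRange (p ^ 2 * q) ↔ s ∈ traceRange q := by
    intro s
    rw [mem_traceRange, mem_traceRange]
    push_cast
    rw [mul_pow, mul_left_comm, mul_lt_mul_iff_right₀ hp2]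
  symm
  refine Finset.sum_nbij (fun s => (p : ℤ) * s) ?_ ?_ ?_ (fun _ _ => rfl)
  · intro s hs
    exact Finset.mem_filter.mpr ⟨(key s).mpr hs, dvd_mul_right _ _⟩
  · intro a _ b _ hab
    exact mul_left_cancel₀ hp0 hab
  · intro t ht
    obtain ⟨ht, s, rfl⟩ := Finset.mem_filter.mp ht
    exact ⟨s, (key s).mp ht, rfl⟩

end Traces

/-! ### Invariant factors -/

section InvariantFactors

variable (A : Type*) [AddCommGroup A] [Finite A]

lemma invFactorOne_eq_exponent : invFactorOne A = AddMonoid.exponent A := by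
  rw [AddMonoid.exponent_eq_iSup_addOrderOf (G := A)
    fun a => (isOfFinAddOrder_of_finite a).addOrderOf_pos]
  rfl

lemma invFactorOne_mul_invFactorTwo : invFactorOne A * invFactorTwo A = Nat.card A := by
  rw [invFactorTwo, Nat.mul_div_cancel']
  rw [invFactorOne_eq_exponent]
  exact AddGroup.exponent_dvd_nat_card

lemma two_dvd_invFactorOne (h : 2 ∣ Nat.card A) : 2 ∣ invFactorOne A := by
  have : Fact (Nat.Prime 2) := ⟨Nat.prime_two⟩
  obtain ⟨a, ha⟩ := exists_prime_addOrderOf_dvd_card' 2 h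
  rw [invFactorOne_eq_exponent, ← ha]
  exact AddMonoid.addOrder_dvd_exponent a

end InvariantFactors

/-! ### Comparison of the sums over traces -/

theorem proposition5p1 (A : Type*) [AddCommGroup A] [Finite A] (hrank : AddGroup.rank A ≤ 2)
    (p v k : ℕ) (hp : p.Prime) (hv : 1 ≤ v) (hk : 2 ≤ k)
    (hcop : Nat.Coprime (p ^ v) (Nat.card A)) :
    omegaOrd A k p v 1 + omegaStar A k p v 1 =
      sigmaSum k (invFactorOne A) (invFactorTwo A) (p ^ v) 1
        - (p : ℝ) ^ (k - 1) *
          sigmaSumQuot k (invFactorOne A) (invFactorTwo A) (p ^ v) p (p : ℤ) := by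
  have hcard := invFactorOne_mul_invFactorTwo A
  have h12 : invFactorTwo A = 2 → 2 ∣ invFactorOne A := fun h =>
    two_dvd_invFactorOne A ⟨invFactorOne A, by rw [← hcard, h, mul_comm]⟩
  have hpA : ¬ p ∣ Nat.card A :=
    (Nat.Prime.coprime_iff_not_dvd hp).mp
      (Nat.Coprime.coprime_dvd_left (dvd_pow_self p (by omega)) hcop)
  have hA : Nat.card A ≠ 0 := Nat.card_pos.ne'
  unfold omegaOrd omegaStar
  generalize invFactorOne A = n₁ at *
  generalize invFactorTwo A = n₂ at *
  rw [← hcard] at hpA hA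
  have hn₁ : n₁ ≠ 0 := left_ne_zero_of_mul hA
  have hn₂ : n₂ ≠ 0 := right_ne_zero_of_mul hA
  have h₁ : ¬ p ∣ n₁ := fun h => hpA (h.mul_right _)
  have h₂ : ¬ p ∣ n₂ := fun h => hpA (h.mul_left _)
  have hp0 := hp.ne_zero
  -- only traces divisible by `p` matter
  rw [sigmaSum, ← Finset.sum_filter_add_sum_filter_not (traceRange (p ^ v)) (fun t => (p : ℤ) ∣ t)
      (fun t => normChebyshev (k - 2) t (p ^ v) * classNumberH n₁ n₂ t (p ^ v) 1),
    ← Finset.sum_filter_add_sum_filter_not (traceRange (p ^ v)) (fun t => (p : ℤ) ∣ t)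
      (fun t => normChebyshev (k - 2) t (p ^ v) * classNumberHStar n₁ n₂ t p v 1),
    Finset.sum_eq_zero (s := (traceRange (p ^ v)).filter (fun t => ¬ (p : ℤ) ∣ t))
      (f := fun t => normChebyshev (k - 2) t (p ^ v) * classNumberHStar n₁ n₂ t p v 1)
      (fun t ht => by
        rw [classNumberHStar_of_not_dvd hp hv hn₁ hn₂ h₁ h₂ h12 (Finset.mem_filter.mp ht).2,
          mul_zero])]
  suffices h : ∑ t ∈ (traceRange (p ^ v)).filter (fun t => (p : ℤ) ∣ t),
        normChebyshev (k - 2) t (p ^ v) * classNumberHStar n₁ n₂ t p v 1 =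
      ∑ t ∈ (traceRange (p ^ v)).filter (fun t => (p : ℤ) ∣ t),
        normChebyshev (k - 2) t (p ^ v) * classNumberH n₁ n₂ t (p ^ v) 1
        - (p : ℝ) ^ (k - 1) * sigmaSumQuot k n₁ n₂ (p ^ v) p p by
    rw [h]
    ring
  obtain rfl | ⟨w, rfl⟩ : v = 1 ∨ ∃ w, v = w + 2 := by
    rcases Nat.lt_or_ge 1 v with h | h
    · exact Or.inr ⟨v - 2, by omega⟩
    · exact Or.inl (by omega)
  · rw [sigmaSumQuot, if_neg, mul_zero, sub_zero]
    · refine Finset.sum_congr rfl fun t ht => ?_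
      obtain ⟨ht, hpt⟩ := Finset.mem_filter.mp ht
      rw [mem_traceRange, pow_one] at ht
      rw [classNumberH_prime hp hn₁ hn₂ h₁ h₂ h12 hpt ht]
    · rw [Nat.pow_dvd_pow_iff_le_right hp.one_lt]
      norm_num
  · have hq : p ^ (w + 2) = p ^ 2 * p ^ w := by ring
    have hk' : (p : ℝ) ^ (k - 1) = p * (p : ℝ) ^ (k - 2) := by
      rw [← pow_succ']
      congr 1
      omega
    rw [sigmaSumQuot, if_pos (pow_dvd_pow p (by omega)), sigmaSum, hk']
    rw [show p ^ (w + 2) / p ^ 2 = p ^ w by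
      rw [hq, Nat.mul_div_cancel_left _ (pow_pos hp.pos 2)]]
    conv_lhs => rw [hq]
    conv_rhs => rw [hq]
    rw [sum_traceRange_filter_dvd hp0, sum_traceRange_filter_dvd hp0, Finset.mul_sum,
      ← Finset.sum_sub_distrib]
    refine Finset.sum_congr rfl fun s hs => ?_
    rw [mem_traceRange] at hs
    push_cast at hs
    rw [← classNumberH_sub_prime_sq hp hn₁ hn₂ h₁ h₂ h12 hs, hq,
      normChebyshev_prime_mul hp0 (pow_ne_zero w hp0)]
    ring
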